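/- **Setting.** Let $\alpha\ge 0$, $\omega_c>0$, $\omega_0,\delta\in\mathbb R$ and $\hbar=1$. For a spectral density $J:\mathbb R\to[0,\infty)$ consider the spin-boson model on $\mathbb C^2\otimes\mathcal F$, with $\mathcal F$ the bosonic Fock space, whose Hamiltonian in the interaction picture with respect to the bath is $$H_J(t)=\tfrac{\omega_0}{2}\sigma_z+\delta\sigma_x+\sigma_x\int d\omega\,\sqrt{J(\omega)}\,\bigl(a_\omega e^{-i\omega t}+a_\omega^\dagger e^{i\omega t}\bigr).$$ Let $U_J(t)=T\exp\bigl(-i\int_0^tH_J(s)\,ds\bigr)$ be given by its Dyson series. For a density matrix $\rho$ of the spin let $\rho_J(t)=\mathrm{tr}_{\mathcal F}\bigl(U_J(t)(\rho\otimes|0\rangle\langle 0|)U_J(t)^\dagger\bigr)$ and $\langle\sigma_z\rangle_J(t)=\mathrm{tr}(\sigma_z\rho_J(t))$. The bath correlation function is $C_J(\tau)=\int J(\omega)e^{-i\omega\tau}\,d\omega$. Let $J(\omega)=2\alpha\omega$ for $\omega\in[0,\omega_c]$ and $J(\omega)=0$ otherwise (Ohmic spectral density). For a time step $\Delta t>0$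 let $J_{\Delta t}(\omega)=J(\omega)$ for $\omega\le\pi/\Delta t$ and $J_{\Delta t}(\omega)=0$ for $\omega>\pi/\Delta t$; this is the part of the bath that a non-Markovian collision model sampling the bath with step $\Delta t$ resolves. Put $\Delta C=C_J-C_{J_{\Delta t}}$, and define the sampling error after a single time step by $$\epsilon_{\rm samp}=\bigl|\langle\sigma_z\rangle_J(\Delta t)-\langle\sigma_z\rangle_{J_{\Delta t}}(\Delta t)\bigr| .$$ **Claim.** For every density matrix $\rho$ and every $\Delta t>0$, both reduced dynamics are well defined at time $\Delta t$: the Dyson series converges for the amplitude of every boson configuration, the traces over the $n$-boson sectors and the sum over $n$ converge, and $\rho_J(\Delta t)$, $\rho_{J_{\Delta t}}(\Delta t)$ are density matrices. Moreover: 1. $\displaystyle \epsilon_{\rm samp}\le\exp\Bigl(4\int_0^{\Delta t}dt'\int_0^{t'}dt''\,|\Delta C(t'-t'')|\Bigr)-1.$ 2. If $\Delta t\le\pi/\omega_c$, then $C_J$ is perfectly reconstructed from its samples, $C_J(\tau)=\sum_{n\in\mathbb Z}C_J(n\Delta t)\,\mathrm{sinc}\bigl(\pi(\tau/\Delta t-n)\bigr)$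 for all $\tau\in\mathbb R$ (with $\mathrm{sinc}\,x=\sin x/x$, $\mathrm{sinc}\,0=1$), $\Delta C=0$, and $\epsilon_{\rm samp}=0$. 3. If $\Delta t\ge\pi/\omega_c$, then for all $\tau\in\mathbb R$ $$\Delta C(\tau)=\int_{\pi/\Delta t}^{\omega_c}2\alpha\omega e^{-i\omega\tau}\,d\omega,$$ which for $\tau\ne0$ equals $$\frac{2\alpha}{\tau^2}\Bigl(e^{-i\omega_c\tau}(1+i\omega_c\tau)-e^{-i\pi\tau/\Delta t}\bigl(1+i\tfrac{\pi\tau}{\Delta t}\bigr)\Bigr),$$ and $$\epsilon_{\rm samp}\le 2\pi^2\alpha\Bigl(\Bigl(\frac{\omega_c\Delta t}{\pi}\Bigr)^2-1\Bigr)\le 2\alpha\omega_c^2\,\Delta t^2 .$$ In particular the sampling error is $O(\Delta t^2)$ on $\Delta t\ge\pi/\omega_c$, with a constant that depends only on $\alpha$ and $\omega_c$. -/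

import Mathlib

noncomputable section

namespace SpinBoson

open scoped ComplexOrder

/-! ### Bath correlation functions -/

/-- The Ohmic spectral density with hard cut-off: `2 α ω` on `[0, ωc]`, zero elsewhere. -/
def ohmicSD (α ωc : ℝ) : ℝ → ℝ :=
  (Set.Icc 0 ωc).indicator fun ω => 2 * α * ω

/-- The part of a spectral density that is resolved with time step `Δt`: the frequencies up to the
Nyquist frequency `π / Δt`. -/
def sampledSD (J : ℝ → ℝ) (Δt : ℝ) : ℝ → ℝ :=
  (Set.Iic (Real.pi / Δt)).indicator J

/-- The (zero temperature) bath correlation function `C(τ) = ∫ J(ω) exp(-i ω τ) dω`. -/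
def bathCorrelation (J : ℝ → ℝ) (τ : ℝ) : ℂ :=
  ∫ ω : ℝ, (J ω : ℂ) * Complex.exp (-Complex.I * ω * τ)

/-- The difference `ΔC` of the exact bath correlation function and the sampled one. -/
def correlationError (J : ℝ → ℝ) (Δt τ : ℝ) : ℂ :=
  bathCorrelation J τ - bathCorrelation (sampledSD J Δt) τ

/-! ### The spin and the bosonic Fock space -/

def σx : Matrix (Fin 2) (Fin 2) ℂ := !![0, 1; 1, 0]

def σz : Matrix (Fin 2) (Fin 2) ℂ := !![1, 0; 0, -1]

/-- The spin Hamiltonian `(ω₀ / 2) σz + δ σx`. -/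
def systemHamiltonian (ω₀ δ : ℝ) : Matrix (Fin 2) (Fin 2) ℂ :=
  ((ω₀ / 2 : ℝ) : ℂ) • σz + (δ : ℂ) • σx

/-- Density matrices of the spin. -/
def IsDensityMatrix (ρ : Matrix (Fin 2) (Fin 2) ℂ) : Prop :=
  ρ.PosSemidef ∧ ρ.trace = 1

/-- Linear maps from `ℂ²` to `ℂ² ⊗ Fock`, given by their boson amplitudes: `Ψ n (ω₁, …, ωₙ)` is the
component with `n` bosons of frequencies `ω₁, …, ωₙ`, a `2 × 2` matrix acting on the spin.
Column `j` of `Ψ` is the spin-boson wave function that evolved from the spin basis state `j`.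
Frequencies range over `ℝ`; a mode that `J` does not couple (such as one of negative frequency)
stays empty. -/
abbrev FockMap := (n : ℕ) → (Fin n → ℝ) → Matrix (Fin 2) (Fin 2) ℂ

/-- `u ↦ u ⊗ |vacuum⟩`. -/
def vacuum : FockMap := fun n _ => if n = 0 then 1 else 0

/-- The annihilation operator `a(f) = ∫ conj (f ω) a_ω dω`. -/
def annihilate (f : ℝ → ℂ) (Ψ : FockMap) : FockMap := fun n ω =>
  ((Real.sqrt (n + 1) : ℝ) : ℂ) •
    Matrix.of fun a b => ∫ x : ℝ, starRingEnd ℂ (f x) * Ψ (n + 1) (Fin.cons x ω) a b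

/-- The creation operator `a†(f) = ∫ f ω a†_ω dω`. -/
def create (f : ℝ → ℂ) (Ψ : FockMap) : FockMap
  | 0, _ => 0
  | n + 1, ω =>
    ((1 / Real.sqrt (n + 1) : ℝ) : ℂ) •
      ∑ j : Fin (n + 1), f (ω j) • Ψ n (fun i => ω (j.succAbove i))

/-- The coupling function `√J(ω) exp(i ω t)` in the interaction picture of the bath. -/
def coupling (J : ℝ → ℝ) (t : ℝ) : ℝ → ℂ := fun ω =>
  ((Real.sqrt (J ω) : ℝ) : ℂ) * Complex.exp (Complex.I * ω * t)

/-- The spin-boson Hamiltonian in the interaction picture with respect to the bath (`ħ = 1`),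
`H(t) = H_S + σx ∫ √J(ω) (a_ω exp(-i ω t) + a†_ω exp(i ω t)) dω`. -/
def hamiltonian (ω₀ δ : ℝ) (J : ℝ → ℝ) (t : ℝ) (Ψ : FockMap) : FockMap := fun n ω =>
  systemHamiltonian ω₀ δ * Ψ n ω +
    σx * (annihilate (coupling J t) Ψ n ω + create (coupling J t) Ψ n ω)

/-! ### Time evolution -/

/-- The `k`-th term of the time-ordered exponential applied to the bath vacuum,
`(-i)^k ∫_{0 ≤ s₁ ≤ … ≤ s_k ≤ t} H(s_k) ⋯ H(s₁) ( · ⊗ |vacuum⟩)`. -/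
def dysonTerm (ω₀ δ : ℝ) (J : ℝ → ℝ) : ℕ → ℝ → FockMap
  | 0, _ => vacuum
  | k + 1, t => fun n ω =>
    (-Complex.I) • Matrix.of fun a b =>
      ∫ s in (0 : ℝ)..t, hamiltonian ω₀ δ J s (dysonTerm ω₀ δ J k s) n ω a b

/-- `u ↦ U(t) (u ⊗ |vacuum⟩)` with `U(t) = T exp(-i ∫₀ᵗ H(s) ds)`. -/
def evolved (ω₀ δ : ℝ) (J : ℝ → ℝ) (t : ℝ) : FockMap := fun n ω =>
  ∑' k : ℕ, dysonTerm ω₀ δ J k t n ω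

/-- The contribution of the `n`-boson sector to the reduced spin state. -/
def sectorState (ω₀ δ : ℝ) (J : ℝ → ℝ) (ρ : Matrix (Fin 2) (Fin 2) ℂ) (t : ℝ) (n : ℕ) :
    Matrix (Fin 2) (Fin 2) ℂ :=
  Matrix.of fun a b => ∫ ω : Fin n → ℝ,
    (evolved ω₀ δ J t n ω * ρ * (evolved ω₀ δ J t n ω).conjTranspose) a b

/-- The reduced spin state `tr_B (U(t) (ρ ⊗ |vacuum⟩⟨vacuum|) U(t)†)`. -/
def reducedState (ω₀ δ : ℝ) (J : ℝ → ℝ) (ρ : Matrix (Fin 2) (Fin 2) ℂ) (t : ℝ) :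
    Matrix (Fin 2) (Fin 2) ℂ :=
  ∑' n : ℕ, sectorState ω₀ δ J ρ t n

/-- The Dyson series, the partial trace over each sector and the sum over the sectors converge, and
the reduced state at time `t` is a density matrix. -/
def EvolutionWellDefined (ω₀ δ : ℝ) (J : ℝ → ℝ) (ρ : Matrix (Fin 2) (Fin 2) ℂ) (t : ℝ) : Prop :=
  (∀ (n : ℕ) (ω : Fin n → ℝ), Summable fun k : ℕ => dysonTerm ω₀ δ J k t n ω) ∧
  (∀ (n : ℕ) (a b : Fin 2), MeasureTheory.Integrable fun ω : Fin n → ℝ =>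
    (evolved ω₀ δ J t n ω * ρ * (evolved ω₀ δ J t n ω).conjTranspose) a b) ∧
  (Summable fun n : ℕ => sectorState ω₀ δ J ρ t n) ∧
  IsDensityMatrix (reducedState ω₀ δ J ρ t)

/-- The expectation value `⟨σz⟩(t)`. -/
def expectSigmaZ (ω₀ δ : ℝ) (J : ℝ → ℝ) (ρ : Matrix (Fin 2) (Fin 2) ℂ) (t : ℝ) : ℂ :=
  (σz * reducedState ω₀ δ J ρ t).trace

/-- The sampling error: the change of `⟨σz⟩` after a single time step `Δt` that is caused by
replacing the bath with the one that is resolved with time step `Δt`. -/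
def samplingError (ω₀ δ : ℝ) (J : ℝ → ℝ) (ρ : Matrix (Fin 2) (Fin 2) ℂ) (Δt : ℝ) : ℝ :=
  ‖expectSigmaZ ω₀ δ J ρ Δt - expectSigmaZ ω₀ δ (sampledSD J Δt) ρ Δt‖

end SpinBoson

end

/-!
Sort the bosons into resolved ones, of frequency at most `π / Δt`, and unresolved ones, and let `P`
be the projection onto the states without unresolved bosons. Let `ψ` and `φ` be the states evolved
with the full and with the resolved bath, and let `h` be the coupling to the unresolved bosons.

By the canonical commutation relations `a(h_s) ψ_t` solves the Schrödinger equation with the source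
`-i ⟨h_s, h_t⟩ σ_x ψ_t`, and `⟨h_s, h_t⟩ = ΔC(s - t)`. As the evolution without a source
preserves the norm, `‖a(h_s) ψ_s‖ ≤ ∫₀ˢ |ΔC|`. Apart from the resolved Hamiltonian, the only term
that feeds `P ψ` is the absorption of an unresolved boson, `-i σ_x P a(h_t) ψ_t`, so that
`‖P ψ - φ‖ ≤ x := ∫₀^Δt ∫₀^t' |ΔC(t' - t'')|`.
Since `ψ` and `φ` have norm one, the expectation values of `σ_z` then differ by at most
`4 x ≤ exp (4 x) - 1`. For the Ohmic bath `|ΔC| ≤ α (ω_c² - (π / Δt)²)`.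
-/

noncomputable section

namespace SpinBoson

open MeasureTheory Filter
open scoped ComplexConjugate ComplexOrder

/-! ### Band-limited couplings -/

/-- Lebesgue measure on the frequency band `[0, Ω]`. -/
def bandMeasure (Ω : ℝ) : Measure ℝ := volume.restrict (Set.Icc 0 Ω)

instance (Ω : ℝ) : IsFiniteMeasure (bandMeasure Ω) :=
  inferInstanceAs (IsFiniteMeasure (volume.restrict (Set.Icc 0 Ω)))

/-- The length of the frequency band `[0, Ω]`, which is zero for negative `Ω`. -/
def bandLength (Ω : ℝ) : ℝ := (bandMeasure Ω).real Set.univ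

lemma bandLength_nonneg (Ω : ℝ) : 0 ≤ bandLength Ω := measureReal_nonneg

/-- Coupling functions that are bounded by `M` and vanish outside the band `[0, Ω]`. -/
structure IsBandLimited (Ω M : ℝ) (f : ℝ → ℂ) : Prop where
  measurable : Measurable f
  norm_le : ∀ x, ‖f x‖ ≤ M
  eq_zero : ∀ x, x ∉ Set.Icc 0 Ω → f x = 0

/-- Time-dependent couplings, band-limited with the same `Ω` and `M` at all times. -/
structure IsBandFamily (Ω M : ℝ) (f : ℝ → ℝ → ℂ) : Prop where
  isBandLimited : ∀ t, IsBandLimited Ω M (f t)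
  continuous : ∀ x, Continuous fun t => f t x

section BandLimited

variable {Ω M : ℝ} {f g : ℝ → ℂ}

lemma IsBandLimited.nonneg (hf : IsBandLimited Ω M f) : 0 ≤ M :=
  (norm_nonneg _).trans (hf.norm_le 0)

lemma IsBandLimited.isBandFamily (hf : IsBandLimited Ω M f) : IsBandFamily Ω M fun _ => f :=
  ⟨fun _ => hf, fun _ => continuous_const⟩

lemma IsBandFamily.nonneg {F : ℝ → ℝ → ℂ} (hF : IsBandFamily Ω M F) : 0 ≤ M :=
  (hF.isBandLimited 0).nonneg

lemma IsBandLimited.measurable_conj (hf : IsBandLimited Ω M f) : Measurable fun x => conj (f x) :=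
  Complex.continuous_conj.measurable.comp hf.measurable

lemma IsBandLimited.norm_conj_mul_le (hf : IsBandLimited Ω M f) (x : ℝ) {z : ℂ} {C : ℝ}
    (hz : ‖z‖ ≤ C) : ‖conj (f x) * z‖ ≤ M * C := by
  rw [norm_mul, RCLike.norm_conj]
  exact mul_le_mul (hf.norm_le x) hz (norm_nonneg _) hf.nonneg

lemma IsBandLimited.integrable_conj_mul (hf : IsBandLimited Ω M f) {F : ℝ → ℂ}
    (hF : Measurable F) {C : ℝ} (hC : ∀ x, ‖F x‖ ≤ C) :
    Integrable (fun x => conj (f x) * F x) (bandMeasure Ω) :=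
  .of_bound (hf.measurable_conj.mul hF).aestronglyMeasurable (M * C)
    (.of_forall fun x => hf.norm_conj_mul_le x (hC x))

end BandLimited

/-! ### Annihilation and creation operators -/

section Ladder

variable {Ω M : ℝ} {f : ℝ → ℂ}

lemma annihilate_apply (hf : IsBandLimited Ω M f) (Ψ : FockMap) (n : ℕ) (ω : Fin n → ℝ)
    (a b : Fin 2) :
    annihilate f Ψ n ω a b = (√(n + 1) : ℝ) *
      ∫ x, conj (f x) * Ψ (n + 1) (Fin.cons x ω) a b ∂bandMeasure Ω := by
  have hband : ∫ x, conj (f x) * Ψ (n + 1) (Fin.cons x ω) a b ∂bandMeasure Ω =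
      ∫ x, conj (f x) * Ψ (n + 1) (Fin.cons x ω) a b :=
    setIntegral_eq_integral_of_forall_compl_eq_zero fun x hx => by simp [hf.eq_zero x hx]
  rw [hband]
  rfl

lemma create_zero_apply (f : ℝ → ℂ) (Ψ : FockMap) (ω : Fin 0 → ℝ) : create f Ψ 0 ω = 0 := rfl

lemma create_succ_apply (f : ℝ → ℂ) (Ψ : FockMap) (n : ℕ) (ω : Fin (n + 1) → ℝ) (a b : Fin 2) :
    create f Ψ (n + 1) ω a b = ((1 / √(n + 1) : ℝ) : ℂ) *
      ∑ j, f (ω j) * Ψ n (fun i => ω (j.succAbove i)) a b := by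
  simp only [create, Matrix.smul_apply, Matrix.sum_apply, smul_eq_mul]

lemma norm_annihilate_le (hf : IsBandLimited Ω M f) {Ψ : FockMap} {n : ℕ} {ω : Fin n → ℝ}
    {a b : Fin 2} {C : ℝ} (hC : ∀ x, ‖Ψ (n + 1) (Fin.cons x ω) a b‖ ≤ C) :
    ‖annihilate f Ψ n ω a b‖ ≤ √(n + 1) * (M * C * bandLength Ω) := by
  rw [annihilate_apply hf, norm_mul, Complex.norm_real, Real.norm_of_nonneg (Real.sqrt_nonneg _)]
  gcongr
  exact norm_integral_le_of_norm_le_const (.of_forall fun x => hf.norm_conj_mul_le x (hC x))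

lemma norm_create_succ_le (hf : IsBandLimited Ω M f) {Ψ : FockMap} {n : ℕ} {a b : Fin 2} {C : ℝ}
    (hC : ∀ ω, ‖Ψ n ω a b‖ ≤ C) (ω : Fin (n + 1) → ℝ) :
    ‖create f Ψ (n + 1) ω a b‖ ≤ √(n + 1) * (M * C) := by
  have hsum : ‖∑ j, f (ω j) * Ψ n (fun i => ω (j.succAbove i)) a b‖ ≤ (n + 1) * (M * C) := by
    refine (norm_sum_le_of_le (n := fun _ => M * C) _ fun j _ => ?_).trans (by simp)
    rw [norm_mul]
    exact mul_le_mul (hf.norm_le _) (hC _) (norm_nonneg _) hf.nonneg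
  rw [create_succ_apply, norm_mul, Complex.norm_real, Real.norm_of_nonneg (by positivity)]
  calc 1 / √(n + 1) * _ ≤ 1 / √(n + 1) * ((n + 1) * (M * C)) := by gcongr
    _ = (n + 1) / √(n + 1) * (M * C) := by ring
    _ = √(n + 1) * (M * C) := by rw [Real.div_sqrt]

lemma sqrt_succ_le_two_pow (n : ℕ) : √(n + 1) ≤ 2 ^ n := by
  have hpow : (n : ℝ) + 1 ≤ 2 ^ n := by exact_mod_cast Nat.lt_two_pow_self (n := n)
  rw [Real.sqrt_le_left (by positivity)]
  exact hpow.trans (le_self_pow₀ (one_le_pow₀ one_le_two) two_ne_zero)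

lemma sqrt_succ_mul_half_pow_le {r : ℝ} (hr : 0 ≤ r) (n : ℕ) : √(n + 1) * (r / 2) ^ n ≤ r ^ n :=
  calc √(n + 1) * (r / 2) ^ n ≤ 2 ^ n * (r / 2) ^ n := by gcongr; exact sqrt_succ_le_two_pow n
    _ = r ^ n := by rw [← mul_pow, mul_div_cancel₀ r two_ne_zero]

end Ladder

/-! ### Rapidly decaying Fock maps -/

/-- Time-dependent Fock maps that are measurable in the frequencies, continuous in time, and decay
faster than any geometric sequence in the number of bosons, locally uniformly in time. -/
structure IsRapidFamily (Ψ : ℝ → FockMap) : Prop where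
  measurable : ∀ t n a b, Measurable fun ω => Ψ t n ω a b
  continuous : ∀ n ω a b, Continuous fun t => Ψ t n ω a b
  bound : ∀ T r : ℝ, 0 < r → ∃ C, ∀ t, |t| ≤ T → ∀ n ω a b, ‖Ψ t n ω a b‖ ≤ C * r ^ n

/-- Measurable Fock maps whose amplitudes decay faster than any geometric sequence in the number of
bosons; all operators of the model are defined on them. -/
abbrev IsRapid (Ψ : FockMap) : Prop := IsRapidFamily fun _ => Ψ

lemma measurable_finCons (n : ℕ) :
    Measurable fun p : ℝ × (Fin n → ℝ) => (Fin.cons p.1 p.2 : Fin (n + 1) → ℝ) :=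
  measurable_pi_lambda _
    (Fin.cases measurable_fst fun i => (measurable_pi_apply i).comp measurable_snd)

lemma IsRapid.exists_norm_le {Ψ : FockMap} (h : IsRapid Ψ) {r : ℝ} (hr : 0 < r) :
    ∃ C, 0 ≤ C ∧ ∀ n ω a b, ‖Ψ n ω a b‖ ≤ C * r ^ n := by
  obtain ⟨C, hC⟩ := h.bound 0 r hr
  have hC := hC 0 (by simp)
  exact ⟨C, by simpa using (norm_nonneg _).trans (hC 0 0 0 0), hC⟩

lemma IsRapid.integrable_conj_mul_cons {Ω M : ℝ} {f : ℝ → ℂ} {Ψ : FockMap} (h : IsRapid Ψ)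
    (hf : IsBandLimited Ω M f) {n : ℕ} (ω : Fin n → ℝ) (a b : Fin 2) :
    Integrable (fun x => conj (f x) * Ψ (n + 1) (Fin.cons x ω) a b) (bandMeasure Ω) := by
  obtain ⟨C, -, hC⟩ := h.exists_norm_le one_pos
  exact hf.integrable_conj_mul ((h.measurable 0 (n + 1) a b).comp
    ((measurable_finCons n).comp measurable_prodMk_right)) fun x => hC _ _ a b

namespace IsRapidFamily

variable {Ω M : ℝ} {f : ℝ → ℝ → ℂ} {Ψ Φ : ℝ → FockMap}

lemma isRapid (h : IsRapidFamily Ψ) (t : ℝ) : IsRapid (Ψ t) where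
  measurable _ := h.measurable t
  continuous _ _ _ _ := continuous_const
  bound _ r hr := (h.bound |t| r hr).imp fun _ hC _ _ => hC t le_rfl

lemma exists_norm_le (h : IsRapidFamily Ψ) (T : ℝ) {r : ℝ} (hr : 0 < r) :
    ∃ C, 0 ≤ C ∧ ∀ t, |t| ≤ T → ∀ n ω a b, ‖Ψ t n ω a b‖ ≤ C * r ^ n := by
  obtain ⟨C, hC⟩ := h.bound T r hr
  exact ⟨|C|, abs_nonneg C, fun t ht n ω a b => (hC t ht n ω a b).trans (by
    gcongr; exact le_abs_self C)⟩

protected lemma add (h : IsRapidFamily Ψ) (h' : IsRapidFamily Φ) :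
    IsRapidFamily fun t => Ψ t + Φ t where
  measurable t n a b := (h.measurable t n a b).add (h'.measurable t n a b)
  continuous n ω a b := (h.continuous n ω a b).add (h'.continuous n ω a b)
  bound T r hr := by
    obtain ⟨C, hC⟩ := h.bound T r hr
    obtain ⟨C', hC'⟩ := h'.bound T r hr
    refine ⟨C + C', fun t ht n ω a b => ?_⟩
    rw [add_mul]
    exact norm_add_le_of_le (hC t ht n ω a b) (hC' t ht n ω a b)

lemma continuous_smul (h : IsRapidFamily Ψ) {c : ℝ → ℂ} (hc : Continuous c) :
    IsRapidFamily fun t => c t • Ψ t where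
  measurable t n a b := (h.measurable t n a b).const_mul (c t)
  continuous n ω a b := hc.mul (h.continuous n ω a b)
  bound T r hr := by
    obtain ⟨C, hC⟩ := h.bound T r hr
    obtain ⟨B, hB⟩ := (isCompact_Icc (a := -T) (b := T)).exists_bound_of_continuousOn
      hc.continuousOn
    refine ⟨B * C, fun t ht n ω a b => ?_⟩
    have hct := hB t (abs_le.1 ht)
    simp only [Pi.smul_apply, Matrix.smul_apply, norm_smul, mul_assoc]
    exact mul_le_mul hct (hC t ht n ω a b) (norm_nonneg _) ((norm_nonneg _).trans hct)

protected lemma smul (h : IsRapidFamily Ψ) (c : ℂ) : IsRapidFamily fun t => c • Ψ t :=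
  h.continuous_smul continuous_const

protected lemma sub (h : IsRapidFamily Ψ) (h' : IsRapidFamily Φ) :
    IsRapidFamily fun t => Ψ t - Φ t := by
  simpa only [sub_eq_add_neg, neg_one_smul] using h.add (h'.smul (-1))

protected lemma matrix_smul (h : IsRapidFamily Ψ) (K : Matrix (Fin 2) (Fin 2) ℂ) :
    IsRapidFamily fun t => K • Ψ t where
  measurable t n a b := by
    simp only [Pi.smul_apply, smul_eq_mul, Matrix.mul_apply]
    exact Finset.measurable_fun_sum _ fun c _ => (h.measurable t n c b).const_mul _
  continuous n ω a b := by
    simp only [Pi.smul_apply, smul_eq_mul, Matrix.mul_apply]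
    exact continuous_finsetSum _ fun c _ => continuous_const.mul (h.continuous n ω c b)
  bound T r hr := by
    obtain ⟨C, hC0, hC⟩ := h.exists_norm_le T hr
    refine ⟨(∑ a, ∑ c, ‖K a c‖) * C, fun t ht n ω a b => ?_⟩
    simp only [Pi.smul_apply, smul_eq_mul, Matrix.mul_apply]
    calc ‖∑ c, K a c * Ψ t n ω c b‖ ≤ ∑ c, ‖K a c‖ * (C * r ^ n) :=
          norm_sum_le_of_le _ fun c _ => by rw [norm_mul]; gcongr; exact hC t ht n ω c b
      _ = (∑ c, ‖K a c‖) * C * r ^ n := by rw [← Finset.sum_mul, mul_assoc]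
      _ ≤ (∑ a, ∑ c, ‖K a c‖) * C * r ^ n := by
          have hrow : ∑ c, ‖K a c‖ ≤ ∑ a, ∑ c, ‖K a c‖ :=
            Finset.single_le_sum (f := fun a => ∑ c, ‖K a c‖) (fun _ _ => by positivity)
              (Finset.mem_univ a)
          exact mul_le_mul_of_nonneg_right (mul_le_mul_of_nonneg_right hrow hC0) (by positivity)

lemma measurable_cons (h : IsRapidFamily Ψ) (t : ℝ) (n : ℕ) (a b : Fin 2) :
    Measurable fun p : ℝ × (Fin n → ℝ) => Ψ t (n + 1) (Fin.cons p.1 p.2) a b :=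
  (h.measurable t (n + 1) a b).comp (measurable_finCons n)

protected lemma annihilate (h : IsRapidFamily Ψ) (hf : IsBandFamily Ω M f) :
    IsRapidFamily fun t => annihilate (f t) (Ψ t) where
  measurable t n a b := by
    simp only [annihilate_apply (hf.isBandLimited t)]
    have hjoint : Measurable fun p : (Fin n → ℝ) × ℝ =>
        conj (f t p.2) * Ψ t (n + 1) (Fin.cons p.2 p.1) a b :=
      ((hf.isBandLimited t).measurable_conj.comp measurable_snd).mul
        ((h.measurable_cons t n a b).comp measurable_swap)
    exact (hjoint.stronglyMeasurable.integral_prod_right').measurable.const_mul _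
  continuous n ω a b := by
    simp only [fun t => annihilate_apply (hf.isBandLimited t)]
    refine continuous_const.mul (continuous_iff_continuousAt.2 fun t₀ => ?_)
    obtain ⟨C, -, hC⟩ := h.exists_norm_le (|t₀| + 1) one_pos
    refine continuousAt_of_dominated (bound := fun _ => M * (C * 1 ^ (n + 1)))
      (.of_forall fun t => ((h.isRapid t).integrable_conj_mul_cons (hf.isBandLimited t) ω a b).1) ?_
      (integrable_const _) (.of_forall fun x => ((Complex.continuous_conj.comp
        (hf.continuous x)).mul (h.continuous _ _ a b)).continuousAt)
    filter_upwards [continuous_abs.continuousAt.eventually_le_const (lt_add_one |t₀|)] with t ht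
    exact .of_forall fun x => (hf.isBandLimited t).norm_conj_mul_le x (hC t ht _ _ a b)
  bound T r hr := by
    obtain ⟨C, hC0, hC⟩ := h.exists_norm_le T (half_pos hr)
    have hM := hf.nonneg
    have hL := bandLength_nonneg Ω
    refine ⟨M * C * bandLength Ω * (r / 2), fun t ht n ω a b => ?_⟩
    calc ‖annihilate (f t) (Ψ t) n ω a b‖
        ≤ √(n + 1) * (M * (C * (r / 2) ^ (n + 1)) * bandLength Ω) :=
          norm_annihilate_le (hf.isBandLimited t) fun x => hC t ht _ _ a b
      _ = M * C * bandLength Ω * (r / 2) * (√(n + 1) * (r / 2) ^ n) := by ring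
      _ ≤ M * C * bandLength Ω * (r / 2) * r ^ n := by
          gcongr
          exact sqrt_succ_mul_half_pow_le hr.le n

protected lemma create (h : IsRapidFamily Ψ) (hf : IsBandFamily Ω M f) :
    IsRapidFamily fun t => create (f t) (Ψ t) where
  measurable t n a b := by
    cases n with
    | zero => exact measurable_const
    | succ n =>
      simp only [create_succ_apply]
      refine (Finset.measurable_fun_sum _ fun j _ => ?_).const_mul _
      exact ((hf.isBandLimited t).measurable.comp (measurable_pi_apply j)).mul
        ((h.measurable t n a b).comp (measurable_pi_lambda _ fun i => measurable_pi_apply _))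
  continuous n ω a b := by
    cases n with
    | zero => exact continuous_const
    | succ n =>
      simp only [create_succ_apply]
      exact continuous_const.mul (continuous_finsetSum _ fun j _ =>
        (hf.continuous _).mul (h.continuous _ _ a b))
  bound T r hr := by
    obtain ⟨C, hC0, hC⟩ := h.exists_norm_le T (half_pos hr)
    have hM := hf.nonneg
    refine ⟨M * C / r, fun t ht n ω a b => ?_⟩
    cases n with
    | zero => simp only [create_zero_apply, Matrix.zero_apply, norm_zero]; positivity
    | succ n =>
      calc ‖create (f t) (Ψ t) (n + 1) ω a b‖ ≤ √(n + 1) * (M * (C * (r / 2) ^ n)) :=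
            norm_create_succ_le (hf.isBandLimited t) (fun ω' => hC t ht n ω' a b) ω
        _ = M * C * (√(n + 1) * (r / 2) ^ n) := by ring
        _ ≤ M * C * r ^ n := by gcongr; exact sqrt_succ_mul_half_pow_le hr.le n
        _ = M * C / r * r ^ (n + 1) := by rw [pow_succ]; field_simp

protected lemma hamiltonian (h : IsRapidFamily Ψ) {J : ℝ → ℝ}
    (hf : IsBandFamily Ω M (coupling J)) (ω₀ δ : ℝ) :
    IsRapidFamily fun t => hamiltonian ω₀ δ J t (Ψ t) :=
  (h.matrix_smul _).add (((h.annihilate hf).add (h.create hf)).matrix_smul _)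

lemma timeIntegral (h : IsRapidFamily Ψ) :
    IsRapidFamily fun t n ω => Matrix.of fun a b => ∫ s in (0 : ℝ)..t, Ψ s n ω a b where
  measurable t n a b := by
    have hjoint : StronglyMeasurable (Function.uncurry fun s ω => Ψ s n ω a b) :=
      stronglyMeasurable_uncurry_of_continuous_of_stronglyMeasurable
        (fun ω => h.continuous n ω a b) fun s => (h.measurable s n a b).stronglyMeasurable
    have hswap := hjoint.comp_measurable measurable_swap
    exact (hswap.integral_prod_right').measurable.sub (hswap.integral_prod_right').measurable
  continuous n ω a b := intervalIntegral.continuous_primitive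
    (fun _ _ => (h.continuous n ω a b).intervalIntegrable _ _) 0
  bound T r hr := by
    obtain ⟨C, hC0, hC⟩ := h.exists_norm_le T hr
    refine ⟨C * T, fun t ht n ω a b => ?_⟩
    calc ‖∫ s in (0 : ℝ)..t, Ψ s n ω a b‖ ≤ C * r ^ n * |t - 0| :=
          intervalIntegral.norm_integral_le_of_norm_le_const fun s hs => hC s (by
            simpa using (Set.abs_sub_left_of_mem_uIcc (Set.uIoc_subset_uIcc hs)).trans
              (by simpa using ht)) n ω a b
      _ ≤ C * r ^ n * T := by rw [sub_zero]; gcongr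
      _ = C * T * r ^ n := by ring

end IsRapidFamily

/-! ### Bosonic symmetry -/

/-- Amplitudes that are invariant under permutations of the bosons. -/
def IsBosonic (Ψ : FockMap) : Prop :=
  ∀ (n : ℕ) (π : Equiv.Perm (Fin n)) (ω : Fin n → ℝ), Ψ n (ω ∘ π) = Ψ n ω

lemma cons_comp_perm {n : ℕ} (x : ℝ) (ω : Fin n → ℝ) (π : Equiv.Perm (Fin n)) :
    (Fin.cons x (ω ∘ π) : Fin (n + 1) → ℝ) =
      (Fin.cons x ω : Fin (n + 1) → ℝ) ∘ Equiv.Perm.decomposeFin.symm (0, π) := by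
  funext i
  cases i using Fin.cases with
  | zero => simp
  | succ i => simp [Equiv.Perm.decomposeFin_symm_apply_succ]

lemma exists_perm_succAbove {n : ℕ} (π : Equiv.Perm (Fin (n + 1))) (j : Fin (n + 1)) :
    ∃ κ : Equiv.Perm (Fin n), ∀ i, π (j.succAbove i) = (π j).succAbove (κ i) := by
  refine ⟨(finSuccAboveEquiv j).trans ((π.subtypeEquiv fun x => by simp).trans
    (finSuccAboveEquiv (π j)).symm), fun i => ?_⟩
  exact (congrArg Subtype.val ((finSuccAboveEquiv (π j)).apply_symm_apply
    ⟨π (j.succAbove i), by simp⟩)).symm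

namespace IsBosonic

variable {Ψ Φ : FockMap}

protected lemma add (hΨ : IsBosonic Ψ) (hΦ : IsBosonic Φ) : IsBosonic (Ψ + Φ) :=
  fun n π ω => congrArg₂ (· + ·) (hΨ n π ω) (hΦ n π ω)

protected lemma matrix_smul (hΨ : IsBosonic Ψ) (K : Matrix (Fin 2) (Fin 2) ℂ) :
    IsBosonic (K • Ψ) :=
  fun n π ω => congrArg (K * ·) (hΨ n π ω)

protected lemma annihilate (hΨ : IsBosonic Ψ) (f : ℝ → ℂ) : IsBosonic (annihilate f Ψ) := by
  intro n π ω
  simp only [SpinBoson.annihilate, cons_comp_perm, hΨ (n + 1)]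

protected lemma create (hΨ : IsBosonic Ψ) (f : ℝ → ℂ) : IsBosonic (create f Ψ) := by
  intro n π ω
  cases n with
  | zero => rfl
  | succ n =>
    simp only [SpinBoson.create]
    rw [← Equiv.sum_comp π fun j => f (ω j) • Ψ n fun i => ω (j.succAbove i)]
    congr 1
    refine Finset.sum_congr rfl fun j _ => ?_
    obtain ⟨κ, hκ⟩ := exists_perm_succAbove π j
    rw [Function.comp_apply, ← hΨ n κ fun i => ω ((π j).succAbove i)]
    simp only [Function.comp_def, hκ]

protected lemma hamiltonian (hΨ : IsBosonic Ψ) (ω₀ δ : ℝ) (J : ℝ → ℝ) (t : ℝ) :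
    IsBosonic (hamiltonian ω₀ δ J t Ψ) :=
  (hΨ.matrix_smul _).add (((hΨ.annihilate _).add (hΨ.create _)).matrix_smul _)

lemma cons_cons_comm (hΨ : IsBosonic Ψ) {n : ℕ} (ω : Fin n → ℝ) (x y : ℝ) :
    Ψ (n + 2) (Fin.cons x (Fin.cons y ω)) = Ψ (n + 2) (Fin.cons y (Fin.cons x ω)) := by
  rw [← hΨ _ (Equiv.swap 0 1)]
  congr 1
  funext i
  cases i using Fin.cases with
  | zero => simp
  | succ i =>
    cases i using Fin.cases with
    | zero => simp
    | succ i =>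
      have hne : i.succ.succ ≠ (1 : Fin (n + 2)) := by simp [Fin.ext_iff]
      rw [Function.comp_apply, Equiv.swap_apply_of_ne_of_ne (Fin.succ_ne_zero _) hne]
      rfl

end IsBosonic

lemma isBosonic_vacuum : IsBosonic vacuum := fun _ _ _ => rfl

/-! ### Canonical commutation relations -/

/-- The inner product `⟨h, f⟩` of two couplings supported in the band `[0, Ω]`. -/
def bandInner (Ω : ℝ) (h f : ℝ → ℂ) : ℂ := ∫ x, conj (h x) * f x ∂bandMeasure Ω

lemma ofReal_sqrt_mul_one_div_sqrt (n : ℕ) :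
    ((√(n + 1) : ℝ) : ℂ) * ((1 / √(n + 1) : ℝ) : ℂ) = 1 := by
  rw [← Complex.ofReal_mul, mul_one_div_cancel (by positivity), Complex.ofReal_one]

lemma cons_comp_succ_succAbove {n : ℕ} (x : ℝ) (ω : Fin (n + 1) → ℝ) (j : Fin (n + 1)) :
    (fun i => (Fin.cons x ω : Fin (n + 2) → ℝ) (j.succ.succAbove i)) =
      Fin.cons x fun i => ω (j.succAbove i) := by
  funext i
  cases i using Fin.cases <;> simp

lemma create_add (f : ℝ → ℂ) (Ψ Φ : FockMap) : create f (Ψ + Φ) = create f Ψ + create f Φ := by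
  funext n ω
  cases n with
  | zero => simp [create]
  | succ n => simp [create, Finset.sum_add_distrib, smul_add]

section Commutation

variable {Ω M M' : ℝ} {f h : ℝ → ℂ} {Ψ Φ : FockMap}

lemma annihilate_add (hh : IsBandLimited Ω M h) (hΨ : IsRapid Ψ) (hΦ : IsRapid Φ) :
    annihilate h (Ψ + Φ) = annihilate h Ψ + annihilate h Φ := by
  ext n ω a b
  simp only [annihilate_apply hh, Pi.add_apply, Matrix.add_apply, mul_add]
  rw [integral_add (hΨ.integrable_conj_mul_cons hh ω a b)
    (hΦ.integrable_conj_mul_cons hh ω a b), mul_add]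

lemma annihilate_matrix_smul (hh : IsBandLimited Ω M h) (hΨ : IsRapid Ψ)
    (K : Matrix (Fin 2) (Fin 2) ℂ) : annihilate h (K • Ψ) = K • annihilate h Ψ := by
  ext n ω a b
  simp only [annihilate_apply hh, Pi.smul_apply, smul_eq_mul, Matrix.mul_apply, Finset.mul_sum,
    mul_left_comm (conj _) (K a _)]
  rw [integral_finsetSum _ fun c _ => (hΨ.integrable_conj_mul_cons hh ω c b).const_mul _,
    Finset.mul_sum]
  simp only [integral_const_mul, mul_left_comm]

lemma annihilate_smul (c : ℂ) : annihilate h (c • Ψ) = c • annihilate h Ψ := by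
  ext n ω a b
  simp only [annihilate, Pi.smul_apply, Matrix.smul_apply, Matrix.of_apply, smul_eq_mul,
    mul_left_comm (conj _) c, integral_const_mul, mul_left_comm]

lemma conj_mul_create_cons (n : ℕ) (ω : Fin n → ℝ) (a b : Fin 2) (x : ℝ) :
    conj (h x) * create f Ψ (n + 1) (Fin.cons x ω) a b =
      ((1 / √(n + 1) : ℝ) : ℂ) * (conj (h x) * f x * Ψ n ω a b +
        ∑ j : Fin n, f (ω j) * (conj (h x) *
          Ψ n (fun i => (Fin.cons x ω : Fin (n + 1) → ℝ) (j.succ.succAbove i)) a b)) := by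
  simp only [create_succ_apply, Fin.sum_univ_succ, Fin.cons_zero, Fin.cons_succ,
    Fin.zero_succAbove, mul_add, Finset.mul_sum]
  congr 1
  · ring
  · exact Finset.sum_congr rfl fun j _ => by ring

lemma create_annihilate_succ_apply (hh : IsBandLimited Ω M h) (n : ℕ) (ω : Fin (n + 1) → ℝ)
    (a b : Fin 2) :
    create f (annihilate h Ψ) (n + 1) ω a b = ∑ j, f (ω j) *
      ∫ x, conj (h x) * Ψ (n + 1) (Fin.cons x fun i => ω (j.succAbove i)) a b ∂bandMeasure Ω := by
  rw [create_succ_apply, Finset.mul_sum]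
  refine Finset.sum_congr rfl fun j _ => ?_
  rw [annihilate_apply hh]
  linear_combination (f (ω j) * ∫ x, conj (h x) *
    Ψ (n + 1) (Fin.cons x fun i => ω (j.succAbove i)) a b ∂bandMeasure Ω) *
    ofReal_sqrt_mul_one_div_sqrt n

theorem annihilate_create (hh : IsBandLimited Ω M h) (hf : IsBandLimited Ω M' f) (hΨ : IsRapid Ψ) :
    annihilate h (create f Ψ) = create f (annihilate h Ψ) + bandInner Ω h f • Ψ := by
  ext n ω a b
  have hint : Integrable (fun x => conj (h x) * f x * Ψ n ω a b) (bandMeasure Ω) :=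
    (hh.integrable_conj_mul hf.measurable hf.norm_le).mul_const _
  simp only [Pi.add_apply, Pi.smul_apply, Matrix.add_apply, Matrix.smul_apply, smul_eq_mul]
  rw [annihilate_apply hh]
  simp only [conj_mul_create_cons]
  rw [integral_const_mul, ← mul_assoc, ofReal_sqrt_mul_one_div_sqrt, one_mul]
  cases n with
  | zero => simp [create_zero_apply, bandInner, integral_mul_const]
  | succ n =>
    simp only [cons_comp_succ_succAbove]
    have hint' (j : Fin (n + 1)) : Integrable (fun x => f (ω j) * (conj (h x) *
        Ψ (n + 1) (Fin.cons x fun i => ω (j.succAbove i)) a b)) (bandMeasure Ω) :=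
      (hΨ.integrable_conj_mul_cons hh _ a b).const_mul _
    rw [integral_add hint (integrable_finsetSum _ fun j _ => hint' j), integral_mul_const,
      integral_finsetSum _ fun j _ => hint' j, create_annihilate_succ_apply hh, add_comm]
    simp only [integral_const_mul, bandInner]

lemma annihilate_annihilate_apply (hh : IsBandLimited Ω M h) (hf : IsBandLimited Ω M' f) (n : ℕ)
    (ω : Fin n → ℝ) (a b : Fin 2) :
    annihilate h (annihilate f Ψ) n ω a b =
      (√(n + 1) : ℝ) * ((√((n + 1 : ℕ) + 1) : ℝ) * ∫ x, ∫ y, conj (h x) * (conj (f y) *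
        Ψ (n + 2) (Fin.cons y (Fin.cons x ω)) a b) ∂bandMeasure Ω ∂bandMeasure Ω) := by
  rw [annihilate_apply hh]
  simp only [annihilate_apply hf, mul_left_comm (conj _) ((√_ : ℝ) : ℂ), integral_const_mul]

lemma IsRapid.integrable_conj_mul_conj_mul_cons_cons (hΨ : IsRapid Ψ) (hh : IsBandLimited Ω M h)
    (hf : IsBandLimited Ω M' f) {n : ℕ} (ω : Fin n → ℝ) (a b : Fin 2) :
    Integrable (fun p : ℝ × ℝ => conj (h p.1) * (conj (f p.2) *
      Ψ (n + 2) (Fin.cons p.2 (Fin.cons p.1 ω)) a b)) ((bandMeasure Ω).prod (bandMeasure Ω)) := by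
  obtain ⟨C, -, hC⟩ := hΨ.exists_norm_le one_pos
  have hcons : Measurable fun p : ℝ × ℝ => (p.2, (Fin.cons p.1 ω : Fin (n + 1) → ℝ)) :=
    measurable_snd.prodMk ((measurable_finCons n).comp (measurable_fst.prodMk measurable_const))
  refine .of_bound (C := M * (M' * (C * 1 ^ (n + 2)))) (Measurable.aestronglyMeasurable ?_)
    (.of_forall fun p => hh.norm_conj_mul_le _ (hf.norm_conj_mul_le _ (hC _ _ a b)))
  exact (hh.measurable_conj.comp measurable_fst).mul ((hf.measurable_conj.comp measurable_snd).mul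
    ((hΨ.measurable_cons 0 (n + 1) a b).comp hcons))

theorem annihilate_comm (hh : IsBandLimited Ω M h) (hf : IsBandLimited Ω M' f) (hΨ : IsRapid Ψ)
    (hsymm : IsBosonic Ψ) : annihilate h (annihilate f Ψ) = annihilate f (annihilate h Ψ) := by
  ext n ω a b
  rw [annihilate_annihilate_apply hh hf, annihilate_annihilate_apply hf hh,
    integral_integral_swap (hΨ.integrable_conj_mul_conj_mul_cons_cons hh hf ω a b)]
  simp only [fun x y => hsymm.cons_cons_comm ω y x, mul_left_comm]

theorem annihilate_hamiltonian {J : ℝ → ℝ} {t : ℝ} (hh : IsBandLimited Ω M h)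
    (hf : IsBandLimited Ω M' (coupling J t)) (hΨ : IsRapid Ψ) (hsymm : IsBosonic Ψ) (ω₀ δ : ℝ) :
    annihilate h (hamiltonian ω₀ δ J t Ψ) =
      hamiltonian ω₀ δ J t (annihilate h Ψ) + bandInner Ω h (coupling J t) • σx • Ψ := by
  have hann : IsRapid (annihilate (coupling J t) Ψ) := hΨ.annihilate hf.isBandFamily
  have hcre : IsRapid (create (coupling J t) Ψ) := hΨ.create hf.isBandFamily
  calc annihilate h (hamiltonian ω₀ δ J t Ψ)
      = annihilate h (systemHamiltonian ω₀ δ • Ψ) + annihilate h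
          (σx • (annihilate (coupling J t) Ψ + create (coupling J t) Ψ)) :=
        annihilate_add hh (hΨ.matrix_smul _) ((hann.add hcre).matrix_smul _)
    _ = systemHamiltonian ω₀ δ • annihilate h Ψ +
          σx • (annihilate h (annihilate (coupling J t) Ψ) +
            annihilate h (create (coupling J t) Ψ)) := by
        rw [annihilate_matrix_smul hh hΨ, annihilate_matrix_smul hh (hann.add hcre),
          annihilate_add hh hann hcre]
    _ = systemHamiltonian ω₀ δ • annihilate h Ψ +
          σx • (annihilate (coupling J t) (annihilate h Ψ) +
            create (coupling J t) (annihilate h Ψ)) +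
          bandInner Ω h (coupling J t) • σx • Ψ := by
        rw [annihilate_comm hh hf hΨ hsymm, annihilate_create hh hf hΨ, ← add_assoc, smul_add,
          smul_comm σx, ← add_assoc]

end Commutation

/-! ### Boson number and band support -/

/-- Fock maps without components of more than `k` bosons. -/
def HasAtMostBosons (k : ℕ) (Ψ : FockMap) : Prop :=
  ∀ (n : ℕ) (ω : Fin n → ℝ), k < n → Ψ n ω = 0

/-- Fock maps all of whose bosons have frequencies in the band `[0, Ω]`. -/
def IsBandSupported (Ω : ℝ) (Ψ : FockMap) : Prop :=
  ∀ (n : ℕ) (ω : Fin n → ℝ) (i : Fin n), ω i ∉ Set.Icc 0 Ω → Ψ n ω = 0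

lemma σx_mul_apply (A : Matrix (Fin 2) (Fin 2) ℂ) (a b : Fin 2) :
    (σx * A) a b = A (1 - a) b := by
  fin_cases a <;> simp [σx, Matrix.mul_apply, Fin.sum_univ_two]

lemma hamiltonian_apply (ω₀ δ : ℝ) (J : ℝ → ℝ) (t : ℝ) (Ψ : FockMap) (n : ℕ) (ω : Fin n → ℝ)
    (a b : Fin 2) :
    hamiltonian ω₀ δ J t Ψ n ω a b = (systemHamiltonian ω₀ δ * Ψ n ω) a b +
      (annihilate (coupling J t) Ψ n ω (1 - a) b + create (coupling J t) Ψ n ω (1 - a) b) := by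
  rw [hamiltonian, Matrix.add_apply, σx_mul_apply, Matrix.add_apply]

lemma hamiltonian_eq_zero {J : ℝ → ℝ} {t : ℝ} {Ψ : FockMap} {n : ℕ} {ω : Fin n → ℝ}
    (hΨ : Ψ n ω = 0) (hann : annihilate (coupling J t) Ψ n ω = 0)
    (hcre : create (coupling J t) Ψ n ω = 0) (ω₀ δ : ℝ) : hamiltonian ω₀ δ J t Ψ n ω = 0 := by
  simp [hamiltonian, hΨ, hann, hcre]

lemma annihilate_eq_zero {Ψ : FockMap} {n : ℕ} {ω : Fin n → ℝ}
    (hΨ : ∀ x, Ψ (n + 1) (Fin.cons x ω) = 0) (f : ℝ → ℂ) : annihilate f Ψ n ω = 0 := by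
  ext a b
  simp [annihilate, hΨ]

section Support

variable {Ψ : FockMap}

lemma hasAtMostBosons_vacuum : HasAtMostBosons 0 vacuum :=
  fun _ _ hn => if_neg hn.ne'

lemma HasAtMostBosons.annihilate {k : ℕ} (h : HasAtMostBosons k Ψ) (f : ℝ → ℂ) :
    HasAtMostBosons k (annihilate f Ψ) :=
  fun n _ hn => annihilate_eq_zero (fun _ => h (n + 1) _ (hn.trans n.lt_succ_self)) f

lemma HasAtMostBosons.create {k : ℕ} (h : HasAtMostBosons k Ψ) (f : ℝ → ℂ) :
    HasAtMostBosons (k + 1) (create f Ψ) := by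
  rintro (_ | n) ω hn
  · rfl
  · simp [SpinBoson.create, fun ω' => h n ω' (Nat.lt_of_succ_lt_succ hn)]

lemma HasAtMostBosons.hamiltonian {k : ℕ} (h : HasAtMostBosons k Ψ) (ω₀ δ : ℝ) (J : ℝ → ℝ)
    (t : ℝ) : HasAtMostBosons (k + 1) (hamiltonian ω₀ δ J t Ψ) :=
  fun n ω hn => hamiltonian_eq_zero (h n ω (k.lt_succ_self.trans hn))
    (h.annihilate _ n ω (k.lt_succ_self.trans hn)) (h.create _ n ω hn) ω₀ δ

lemma isBandSupported_vacuum (Ω : ℝ) : IsBandSupported Ω vacuum :=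
  fun _ _ i _ => if_neg fun hn => (hn ▸ i).elim0

lemma IsBandSupported.annihilate {Ω : ℝ} (h : IsBandSupported Ω Ψ) (f : ℝ → ℂ) :
    IsBandSupported Ω (annihilate f Ψ) :=
  fun n _ i hi => annihilate_eq_zero (fun _ => h (n + 1) _ i.succ (by simpa using hi)) f

lemma IsBandSupported.create {Ω M : ℝ} (h : IsBandSupported Ω Ψ) {f : ℝ → ℂ}
    (hf : IsBandLimited Ω M f) : IsBandSupported Ω (create f Ψ) := by
  rintro (_ | n) ω i hi
  · rfl
  · have hterm (j : Fin (n + 1)) : f (ω j) • Ψ n (fun l => ω (j.succAbove l)) = 0 := by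
      rcases eq_or_ne i j with rfl | hij
      · rw [hf.eq_zero _ hi, zero_smul]
      · obtain ⟨l, rfl⟩ := Fin.exists_succAbove_eq hij
        rw [h n _ l hi, smul_zero]
    simp [SpinBoson.create, hterm]

lemma IsBandSupported.hamiltonian {Ω M : ℝ} (h : IsBandSupported Ω Ψ) {J : ℝ → ℝ} {t : ℝ}
    (hf : IsBandLimited Ω M (coupling J t)) (ω₀ δ : ℝ) :
    IsBandSupported Ω (hamiltonian ω₀ δ J t Ψ) :=
  fun n ω i hi => hamiltonian_eq_zero (h n ω i hi) (h.annihilate _ n ω i hi)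
    (h.create hf n ω i hi) ω₀ δ

end Support

/-! ### Bounds on the Hamiltonian -/

lemma norm_systemHamiltonian_mul_le (ω₀ δ : ℝ) {A : Matrix (Fin 2) (Fin 2) ℂ} {C : ℝ}
    (hC : ∀ a b, ‖A a b‖ ≤ C) (a b : Fin 2) :
    ‖(systemHamiltonian ω₀ δ * A) a b‖ ≤ (|ω₀ / 2| + |δ|) * C := by
  have hz : ‖(σz * A) a b‖ = ‖A a b‖ := by
    fin_cases a <;> simp [σz, Matrix.mul_apply, Fin.sum_univ_two]
  calc ‖(systemHamiltonian ω₀ δ * A) a b‖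
      = ‖((ω₀ / 2 : ℝ) : ℂ) * (σz * A) a b + (δ : ℂ) * A (1 - a) b‖ := by
        rw [systemHamiltonian, add_mul, Matrix.add_apply, Matrix.smul_mul, Matrix.smul_mul,
          Matrix.smul_apply, Matrix.smul_apply, σx_mul_apply, smul_eq_mul, smul_eq_mul]
    _ ≤ |ω₀ / 2| * ‖A a b‖ + |δ| * ‖A (1 - a) b‖ := by
        refine (norm_add_le _ _).trans_eq ?_
        simp only [norm_mul, Complex.norm_real, Real.norm_eq_abs, hz]
    _ ≤ (|ω₀ / 2| + |δ|) * C := by rw [add_mul]; gcongr <;> apply hC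

/-- The growth rate of the Dyson series: on at most `k` bosons, the Hamiltonian is bounded by
`√(k + 1)` times this constant. -/
def dysonRate (ω₀ δ Ω M : ℝ) : ℝ := |ω₀ / 2| + |δ| + (M * bandLength Ω + M)

lemma dysonRate_nonneg (ω₀ δ Ω : ℝ) {M : ℝ} (hM : 0 ≤ M) : 0 ≤ dysonRate ω₀ δ Ω M := by
  have := bandLength_nonneg Ω
  unfold dysonRate
  positivity

section Bounds

variable {Ω M C : ℝ} {k : ℕ} {f : ℝ → ℂ} {Ψ : FockMap}

lemma HasAtMostBosons.norm_annihilate_le (hk : HasAtMostBosons k Ψ) (hf : IsBandLimited Ω M f)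
    (hC : ∀ n ω a b, ‖Ψ n ω a b‖ ≤ C) (n : ℕ) (ω : Fin n → ℝ) (a b : Fin 2) :
    ‖SpinBoson.annihilate f Ψ n ω a b‖ ≤ √(k + 1) * (M * C * bandLength Ω) := by
  have hC0 : 0 ≤ C := (norm_nonneg _).trans (hC 0 0 0 0)
  have hM := hf.nonneg
  have hL := bandLength_nonneg Ω
  rcases lt_or_ge k n with hn | hn
  · rw [hk.annihilate f n ω hn, Matrix.zero_apply, norm_zero]
    positivity
  · refine (SpinBoson.norm_annihilate_le hf fun x => hC _ _ _ _).trans ?_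
    gcongr

lemma HasAtMostBosons.norm_create_le (hk : HasAtMostBosons k Ψ) (hf : IsBandLimited Ω M f)
    (hC : ∀ n ω a b, ‖Ψ n ω a b‖ ≤ C) (n : ℕ) (ω : Fin n → ℝ) (a b : Fin 2) :
    ‖SpinBoson.create f Ψ n ω a b‖ ≤ √(k + 1) * (M * C) := by
  have hC0 : 0 ≤ C := (norm_nonneg _).trans (hC 0 0 0 0)
  have hM := hf.nonneg
  rcases lt_or_ge (k + 1) n with hn | hn
  · rw [hk.create f n ω hn, Matrix.zero_apply, norm_zero]
    positivity
  · cases n with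
    | zero => rw [create_zero_apply, Matrix.zero_apply, norm_zero]; positivity
    | succ n =>
      refine (norm_create_succ_le hf (fun ω' => hC n ω' a b) ω).trans ?_
      gcongr
      exact_mod_cast Nat.le_of_succ_le_succ hn

lemma HasAtMostBosons.norm_hamiltonian_le (hk : HasAtMostBosons k Ψ) {J : ℝ → ℝ} {t : ℝ}
    (hf : IsBandLimited Ω M (coupling J t)) (hC : ∀ n ω a b, ‖Ψ n ω a b‖ ≤ C) (ω₀ δ : ℝ)
    (n : ℕ) (ω : Fin n → ℝ) (a b : Fin 2) :
    ‖SpinBoson.hamiltonian ω₀ δ J t Ψ n ω a b‖ ≤ dysonRate ω₀ δ Ω M * (√(k + 1) * C) := by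
  have hC0 : 0 ≤ C := (norm_nonneg _).trans (hC 0 0 0 0)
  have hsqrt : 1 ≤ √((k : ℝ) + 1) := Real.one_le_sqrt.2 (by simp)
  rw [hamiltonian_apply]
  calc _ ≤ (|ω₀ / 2| + |δ|) * C + (√(k + 1) * (M * C * bandLength Ω) + √(k + 1) * (M * C)) :=
        norm_add_le_of_le (norm_systemHamiltonian_mul_le ω₀ δ (hC n ω) a b)
          (norm_add_le_of_le (hk.norm_annihilate_le hf hC n ω _ b)
            (hk.norm_create_le hf hC n ω _ b))
    _ ≤ (|ω₀ / 2| + |δ|) * (√(k + 1) * C) +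
          (√(k + 1) * (M * C * bandLength Ω) + √(k + 1) * (M * C)) := by
        gcongr
        exact le_mul_of_one_le_left hC0 hsqrt
    _ = dysonRate ω₀ δ Ω M * (√(k + 1) * C) := by unfold dysonRate; ring

end Bounds

/-! ### The Dyson series -/

lemma isRapid_vacuum : IsRapid vacuum where
  measurable _ _ _ _ := measurable_const
  continuous _ _ _ _ := continuous_const
  bound _ r hr := by
    refine ⟨1, fun _ _ n ω a b => ?_⟩
    rcases n with _ | n
    · fin_cases a <;> fin_cases b <;> simp [vacuum]
    · simp [vacuum, hr.le]

lemma dysonTerm_succ_apply (ω₀ δ : ℝ) (J : ℝ → ℝ) (k : ℕ) (t : ℝ) (n : ℕ) (ω : Fin n → ℝ)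
    (a b : Fin 2) :
    dysonTerm ω₀ δ J (k + 1) t n ω a b =
      -Complex.I * ∫ s in (0 : ℝ)..t, hamiltonian ω₀ δ J s (dysonTerm ω₀ δ J k s) n ω a b :=
  rfl

lemma dysonTerm_succ_eq_zero {ω₀ δ : ℝ} {J : ℝ → ℝ} {k n : ℕ} {ω : Fin n → ℝ}
    (h : ∀ s, hamiltonian ω₀ δ J s (dysonTerm ω₀ δ J k s) n ω = 0) (t : ℝ) :
    dysonTerm ω₀ δ J (k + 1) t n ω = 0 := by
  ext a b
  simp [dysonTerm_succ_apply, h]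

lemma isBosonic_dysonTerm (ω₀ δ : ℝ) (J : ℝ → ℝ) (k : ℕ) (t : ℝ) :
    IsBosonic (dysonTerm ω₀ δ J k t) := by
  induction k generalizing t with
  | zero => exact isBosonic_vacuum
  | succ k ih =>
    intro n π ω
    simp only [dysonTerm, fun s => (ih s).hamiltonian ω₀ δ J s n π ω]

lemma hasAtMostBosons_dysonTerm (ω₀ δ : ℝ) (J : ℝ → ℝ) (k : ℕ) (t : ℝ) :
    HasAtMostBosons k (dysonTerm ω₀ δ J k t) := by
  induction k generalizing t with
  | zero => exact hasAtMostBosons_vacuum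
  | succ k ih =>
    exact fun n ω hn => dysonTerm_succ_eq_zero (fun s => (ih s).hamiltonian ω₀ δ J s n ω hn) t

lemma norm_integral_le_of_norm_le_mul_abs_pow {g : ℝ → ℂ} {A : ℝ} {k : ℕ}
    (hg : ∀ s, ‖g s‖ ≤ A * |s| ^ k) (t : ℝ) :
    ‖∫ s in (0 : ℝ)..t, g s‖ ≤ A * (|t| ^ (k + 1) / (k + 1)) := by
  have hint : IntegrableOn (fun s : ℝ => A * |s - 0| ^ k) (Set.uIoc 0 t) :=
    ((by fun_prop : Continuous fun s : ℝ => A * |s - 0| ^ k).intervalIntegrable 0 t).def'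
  calc ‖∫ s in (0 : ℝ)..t, g s‖ = ‖∫ s in Set.uIoc 0 t, g s‖ :=
        intervalIntegral.norm_intervalIntegral_eq g 0 t volume
    _ ≤ ∫ s in Set.uIoc 0 t, A * |s - 0| ^ k :=
        norm_integral_le_of_norm_le hint (.of_forall fun s => by rw [sub_zero]; exact hg s)
    _ = A * (|t| ^ (k + 1) / (k + 1)) := by
        rw [integral_const_mul, integral_pow_abs_sub_uIoc, sub_zero]

-- Cauchy–Schwarz against the geometric series reduces this to the exponential series.
lemma summable_pow_div_sqrt_factorial (x : ℝ) :
    Summable fun k : ℕ => x ^ k / √k.factorial := by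
  have hsum : Summable fun k : ℕ => ((2 * x) ^ 2) ^ k / k.factorial + (1 / 4 : ℝ) ^ k :=
    (Real.summable_pow_div_factorial _).add
      (summable_geometric_of_lt_one (by norm_num) (by norm_num))
  refine .of_norm_bounded hsum fun k => ?_
  have hsplit : x ^ k / √k.factorial = (2 * x) ^ k / √k.factorial * (1 / 2) ^ k := by
    rw [div_mul_eq_mul_div, ← mul_pow]
    ring_nf
  have hexp : ((2 * x) ^ 2) ^ k / k.factorial = |(2 * x) ^ k / √k.factorial| ^ 2 := by
    rw [sq_abs, div_pow, Real.sq_sqrt (by positivity), pow_right_comm]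
  have hgeom : (1 / 4 : ℝ) ^ k = |(1 / 2) ^ k| ^ 2 := by
    rw [sq_abs, pow_right_comm]
    norm_num
  rw [hsplit, hexp, hgeom, Real.norm_eq_abs, abs_mul]
  nlinarith [two_mul_le_add_sq |(2 * x) ^ k / √k.factorial| |(1 / 2 : ℝ) ^ k|,
    mul_nonneg (abs_nonneg ((2 * x) ^ k / √k.factorial)) (abs_nonneg ((1 / 2 : ℝ) ^ k))]

section Dyson

variable {Ω M : ℝ} {J : ℝ → ℝ}

lemma isBandSupported_dysonTerm (hf : IsBandFamily Ω M (coupling J)) (ω₀ δ : ℝ) (k : ℕ) (t : ℝ) :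
    IsBandSupported Ω (dysonTerm ω₀ δ J k t) := by
  induction k generalizing t with
  | zero => exact isBandSupported_vacuum Ω
  | succ k ih =>
    exact fun n ω i hi => dysonTerm_succ_eq_zero
      (fun s => (ih s).hamiltonian (hf.isBandLimited s) ω₀ δ n ω i hi) t

lemma isRapidFamily_dysonTerm (hf : IsBandFamily Ω M (coupling J)) (ω₀ δ : ℝ) (k : ℕ) :
    IsRapidFamily (dysonTerm ω₀ δ J k) := by
  induction k with
  | zero => exact isRapid_vacuum
  | succ k ih => exact ((ih.hamiltonian hf ω₀ δ).timeIntegral).smul _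

lemma norm_dysonTerm_le (hf : IsBandFamily Ω M (coupling J)) (ω₀ δ : ℝ) (k : ℕ) (t : ℝ) (n : ℕ)
    (ω : Fin n → ℝ) (a b : Fin 2) :
    ‖dysonTerm ω₀ δ J k t n ω a b‖ ≤ (dysonRate ω₀ δ Ω M * |t|) ^ k / √k.factorial := by
  induction k generalizing t n a b with
  | zero => by_cases hn : n = 0 <;> fin_cases a <;> fin_cases b <;> simp [dysonTerm, vacuum, hn]
  | succ k ih =>
    set K := dysonRate ω₀ δ Ω M
    have hH (s : ℝ) : ‖hamiltonian ω₀ δ J s (dysonTerm ω₀ δ J k s) n ω a b‖ ≤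
        K ^ (k + 1) * √(k + 1) / √k.factorial * |s| ^ k :=
      ((hasAtMostBosons_dysonTerm ω₀ δ J k s).norm_hamiltonian_le (hf.isBandLimited s) (ih s)
        ω₀ δ n ω a b).trans_eq (by rw [mul_pow]; ring)
    rw [dysonTerm_succ_apply, norm_mul, norm_neg, Complex.norm_I, one_mul]
    calc _ ≤ K ^ (k + 1) * √(k + 1) / √k.factorial * (|t| ^ (k + 1) / (k + 1)) :=
          norm_integral_le_of_norm_le_mul_abs_pow hH t
      _ = (K * |t|) ^ (k + 1) / √(k + 1).factorial := by
          rw [Nat.factorial_succ, Nat.cast_mul, Real.sqrt_mul (by positivity), mul_pow]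
          push_cast
          field_simp
          rw [Real.sq_sqrt (by positivity)]

lemma summable_dysonTerm (hf : IsBandFamily Ω M (coupling J)) (ω₀ δ t : ℝ) (n : ℕ)
    (ω : Fin n → ℝ) : Summable fun k => dysonTerm ω₀ δ J k t n ω :=
  Pi.summable.2 fun a => Pi.summable.2 fun b =>
    .of_norm_bounded (summable_pow_div_sqrt_factorial (dysonRate ω₀ δ Ω M * |t|)) fun k =>
      norm_dysonTerm_le hf ω₀ δ k t n ω a b

lemma hasSum_dysonTerm (hf : IsBandFamily Ω M (coupling J)) (ω₀ δ t : ℝ) (n : ℕ)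
    (ω : Fin n → ℝ) (a b : Fin 2) :
    HasSum (fun k => dysonTerm ω₀ δ J k t n ω a b) (evolved ω₀ δ J t n ω a b) :=
  Pi.hasSum.1 (Pi.hasSum.1 (summable_dysonTerm hf ω₀ δ t n ω).hasSum a) b

end Dyson

/-! ### The evolved state and the Schrödinger equation -/

lemma isBosonic_evolved (ω₀ δ : ℝ) (J : ℝ → ℝ) (t : ℝ) : IsBosonic (evolved ω₀ δ J t) := by
  intro n π ω
  simp only [evolved, fun k => isBosonic_dysonTerm ω₀ δ J k t n π ω]

section TermwiseHamiltonian

variable {Ω M : ℝ} {f : ℝ → ℂ} {Ψ : ℕ → FockMap} {Φ : FockMap} {u : ℕ → ℝ}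

lemma hasSum_annihilate (hf : IsBandLimited Ω M f) (hΨ : ∀ k, IsRapid (Ψ k)) (hu : Summable u)
    (hbound : ∀ k n ω a b, ‖Ψ k n ω a b‖ ≤ u k)
    (hsum : ∀ n ω a b, HasSum (fun k => Ψ k n ω a b) (Φ n ω a b))
    (n : ℕ) (ω : Fin n → ℝ) (a b : Fin 2) :
    HasSum (fun k => annihilate f (Ψ k) n ω a b) (annihilate f Φ n ω a b) := by
  simp only [annihilate_apply hf]
  refine HasSum.mul_left _ ?_
  have hnorm (k : ℕ) : ∫ x, ‖conj (f x) * Ψ k (n + 1) (Fin.cons x ω) a b‖ ∂bandMeasure Ω ≤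
      M * bandLength Ω * u k :=
    calc _ ≤ ∫ _, M * u k ∂bandMeasure Ω :=
          integral_mono ((hΨ k).integrable_conj_mul_cons hf ω a b).norm (integrable_const _)
            fun x => hf.norm_conj_mul_le x (hbound _ _ _ _ _)
      _ = M * bandLength Ω * u k := by rw [integral_const, smul_eq_mul, bandLength]; ring
  have hintegral := hasSum_integral_of_summable_integral_norm
    (fun k => (hΨ k).integrable_conj_mul_cons hf ω a b)
    ((hu.mul_left (M * bandLength Ω)).of_nonneg_of_le (fun k => by positivity) hnorm)
  simpa only [fun x => ((hsum (n + 1) (Fin.cons x ω) a b).mul_left (conj (f x))).tsum_eq]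
    using hintegral

lemma hasSum_create (f : ℝ → ℂ) (hsum : ∀ n ω a b, HasSum (fun k => Ψ k n ω a b) (Φ n ω a b))
    (n : ℕ) (ω : Fin n → ℝ) (a b : Fin 2) :
    HasSum (fun k => create f (Ψ k) n ω a b) (create f Φ n ω a b) := by
  cases n with
  | zero => exact hasSum_zero
  | succ n =>
    simp only [create_succ_apply]
    exact (hasSum_sum fun j _ => (hsum _ _ _ _).mul_left _).mul_left _

lemma hasSum_hamiltonian {J : ℝ → ℝ} {t : ℝ} (hf : IsBandLimited Ω M (coupling J t))
    (hΨ : ∀ k, IsRapid (Ψ k)) (hu : Summable u) (hbound : ∀ k n ω a b, ‖Ψ k n ω a b‖ ≤ u k)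
    (hsum : ∀ n ω a b, HasSum (fun k => Ψ k n ω a b) (Φ n ω a b)) (ω₀ δ : ℝ)
    (n : ℕ) (ω : Fin n → ℝ) (a b : Fin 2) :
    HasSum (fun k => hamiltonian ω₀ δ J t (Ψ k) n ω a b) (hamiltonian ω₀ δ J t Φ n ω a b) := by
  simp only [hamiltonian_apply, Matrix.mul_apply]
  exact (hasSum_sum fun c _ => (hsum n ω c b).mul_left _).add
    ((hasSum_annihilate hf hΨ hu hbound hsum n ω _ b).add (hasSum_create _ hsum n ω _ b))

end TermwiseHamiltonian

section Evolved

variable {Ω M : ℝ} {J : ℝ → ℝ}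

lemma isBandSupported_evolved (hf : IsBandFamily Ω M (coupling J)) (ω₀ δ t : ℝ) :
    IsBandSupported Ω (evolved ω₀ δ J t) := fun n ω i hi => by
  simp only [evolved, fun k => isBandSupported_dysonTerm hf ω₀ δ k t n ω i hi, tsum_zero]

lemma evolved_eq_vacuum_add_tsum (hf : IsBandFamily Ω M (coupling J)) (ω₀ δ t : ℝ) (n : ℕ)
    (ω : Fin n → ℝ) (a b : Fin 2) :
    evolved ω₀ δ J t n ω a b = vacuum n ω a b + ∑' k, dysonTerm ω₀ δ J (k + 1) t n ω a b := by
  have hsum := hasSum_dysonTerm hf ω₀ δ t n ω a b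
  rw [← hsum.tsum_eq, hsum.summable.tsum_eq_zero_add]
  rfl

lemma evolved_zero (hf : IsBandFamily Ω M (coupling J)) (ω₀ δ : ℝ) :
    evolved ω₀ δ J 0 = vacuum := by
  ext n ω a b
  simp [evolved_eq_vacuum_add_tsum hf, dysonTerm_succ_apply]

lemma hasDerivAt_dysonTerm_succ (hf : IsBandFamily Ω M (coupling J)) (ω₀ δ : ℝ) (k : ℕ) (t : ℝ)
    (n : ℕ) (ω : Fin n → ℝ) (a b : Fin 2) :
    HasDerivAt (fun s => dysonTerm ω₀ δ J (k + 1) s n ω a b)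
      (-Complex.I * hamiltonian ω₀ δ J t (dysonTerm ω₀ δ J k t) n ω a b) t :=
  ((((isRapidFamily_dysonTerm hf ω₀ δ k).hamiltonian hf ω₀ δ).continuous n ω a
    b).integral_hasStrictDerivAt 0 t).hasDerivAt.const_mul _

lemma norm_hamiltonian_dysonTerm_le (hf : IsBandFamily Ω M (coupling J)) (ω₀ δ : ℝ) (k : ℕ)
    {t T : ℝ} (ht : |t| ≤ T) (n : ℕ) (ω : Fin n → ℝ) (a b : Fin 2) :
    ‖hamiltonian ω₀ δ J t (dysonTerm ω₀ δ J k t) n ω a b‖ ≤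
      dysonRate ω₀ δ Ω M * ((2 * (dysonRate ω₀ δ Ω M * T)) ^ k / √k.factorial) := by
  have hK := dysonRate_nonneg ω₀ δ Ω hf.nonneg
  set K := dysonRate ω₀ δ Ω M
  calc _ ≤ K * (√(k + 1) * ((K * |t|) ^ k / √k.factorial)) :=
        (hasAtMostBosons_dysonTerm ω₀ δ J k t).norm_hamiltonian_le (hf.isBandLimited t)
          (norm_dysonTerm_le hf ω₀ δ k t) ω₀ δ n ω a b
    _ ≤ K * (2 ^ k * ((K * T) ^ k / √k.factorial)) := by
        gcongr
        exact sqrt_succ_le_two_pow k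
    _ = K * ((2 * (K * T)) ^ k / √k.factorial) := by rw [mul_pow 2]; ring

theorem hasDerivAt_evolved (hf : IsBandFamily Ω M (coupling J)) (ω₀ δ t : ℝ) (n : ℕ)
    (ω : Fin n → ℝ) (a b : Fin 2) :
    HasDerivAt (fun t => evolved ω₀ δ J t n ω a b)
      (-Complex.I * hamiltonian ω₀ δ J t (evolved ω₀ δ J t) n ω a b) t := by
  have htsum : ∑' k, -Complex.I * hamiltonian ω₀ δ J t (dysonTerm ω₀ δ J k t) n ω a b =
      -Complex.I * hamiltonian ω₀ δ J t (evolved ω₀ δ J t) n ω a b :=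
    ((hasSum_hamiltonian (hf.isBandLimited t)
      (fun k => (isRapidFamily_dysonTerm hf ω₀ δ k).isRapid t)
      (summable_pow_div_sqrt_factorial _) (fun k => norm_dysonTerm_le hf ω₀ δ k t)
      (hasSum_dysonTerm hf ω₀ δ t) ω₀ δ n ω a b).mul_left _).tsum_eq
  have ht : t ∈ Metric.ball (0 : ℝ) (|t| + 1) := by simp
  rw [funext fun s => evolved_eq_vacuum_add_tsum hf ω₀ δ s n ω a b, ← htsum]
  refine (hasDerivAt_tsum_of_isPreconnected
    ((summable_pow_div_sqrt_factorial (2 * (dysonRate ω₀ δ Ω M * (|t| + 1)))).mul_left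
      (dysonRate ω₀ δ Ω M)) Metric.isOpen_ball (convex_ball _ _).isPreconnected
    (fun k s _ => hasDerivAt_dysonTerm_succ hf ω₀ δ k s n ω a b) (fun k s hs => ?_) ht
    ((summable_nat_add_iff 1).2 (hasSum_dysonTerm hf ω₀ δ t n ω a b).summable) ht).const_add _
  rw [norm_mul, norm_neg, Complex.norm_I, one_mul]
  exact norm_hamiltonian_dysonTerm_le hf ω₀ δ k (by simpa using (mem_ball_zero_iff.1 hs).le) n ω a b

lemma norm_dysonTerm_le_mul_pow (hf : IsBandFamily Ω M (coupling J)) (ω₀ δ : ℝ) (k : ℕ)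
    {t T r : ℝ} (ht : |t| ≤ T) (hr : 0 < r) (hr1 : r ≤ 1) (n : ℕ) (ω : Fin n → ℝ) (a b : Fin 2) :
    ‖dysonTerm ω₀ δ J k t n ω a b‖ ≤
      (dysonRate ω₀ δ Ω M * T / r) ^ k / √k.factorial * r ^ n := by
  have hK := dysonRate_nonneg ω₀ δ Ω hf.nonneg
  have hT : 0 ≤ T := (abs_nonneg t).trans ht
  set K := dysonRate ω₀ δ Ω M
  rcases lt_or_ge k n with hn | hn
  · rw [hasAtMostBosons_dysonTerm ω₀ δ J k t n ω hn, Matrix.zero_apply, norm_zero]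
    positivity
  · calc ‖dysonTerm ω₀ δ J k t n ω a b‖ ≤ (K * |t|) ^ k / √k.factorial :=
          norm_dysonTerm_le hf ω₀ δ k t n ω a b
      _ ≤ (K * T) ^ k / √k.factorial := by gcongr
      _ = (K * T / r) ^ k / √k.factorial * r ^ k := by rw [div_pow]; field_simp
      _ ≤ (K * T / r) ^ k / √k.factorial * r ^ n := by
          gcongr ?_ * ?_
          exact pow_le_pow_of_le_one hr.le hr1 hn

lemma isRapidFamily_evolved (hf : IsBandFamily Ω M (coupling J)) (ω₀ δ : ℝ) :
    IsRapidFamily (evolved ω₀ δ J) where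
  measurable t n a b := measurable_of_tendsto_metrizable
    (fun N => Finset.measurable_fun_sum (Finset.range N) fun k _ =>
      (isRapidFamily_dysonTerm hf ω₀ δ k).measurable t n a b)
    (tendsto_pi_nhds.2 fun ω => (hasSum_dysonTerm hf ω₀ δ t n ω a b).tendsto_sum_nat)
  continuous n ω a b := continuous_iff_continuousAt.2 fun t =>
    (hasDerivAt_evolved hf ω₀ δ t n ω a b).continuousAt
  bound T r hr := by
    have hsum := summable_pow_div_sqrt_factorial (dysonRate ω₀ δ Ω M * |T| / min r 1)
    have hK := dysonRate_nonneg ω₀ δ Ω hf.nonneg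
    have hmin : 0 < min r 1 := lt_min hr one_pos
    refine ⟨∑' k : ℕ, (dysonRate ω₀ δ Ω M * |T| / min r 1) ^ k / √k.factorial,
      fun t ht n ω a b => ?_⟩
    calc ‖evolved ω₀ δ J t n ω a b‖ ≤
          (∑' k : ℕ, (dysonRate ω₀ δ Ω M * |T| / min r 1) ^ k / √k.factorial) * min r 1 ^ n := by
          rw [← (hasSum_dysonTerm hf ω₀ δ t n ω a b).tsum_eq]
          exact tsum_of_norm_bounded (hsum.hasSum.mul_right _) fun k =>
            norm_dysonTerm_le_mul_pow hf ω₀ δ k (ht.trans (le_abs_self T)) hmin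
              (min_le_right r 1) n ω a b
      _ ≤ _ := by
          gcongr
          exact min_le_left r 1

end Evolved

/-! ### Integration over boson configurations -/

/-- Boson configurations: the number of bosons and their frequencies. -/
abbrev BosonConfig := (n : ℕ) × (Fin n → ℝ)

/-- Lebesgue measure on the `n`-boson configurations with frequencies in the band `[0, Ω]`. -/
abbrev sectorMeasure (Ω : ℝ) (n : ℕ) : Measure (Fin n → ℝ) := Measure.pi fun _ => bandMeasure Ω

/-- Lebesgue measure on all boson configurations with frequencies in the band `[0, Ω]`. -/
def fockMeasure (Ω : ℝ) : Measure BosonConfig :=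
  Measure.sum fun n => (sectorMeasure Ω n).map (Sigma.mk n)

lemma sectorMeasure_real_univ (Ω : ℝ) (n : ℕ) :
    (sectorMeasure Ω n).real Set.univ = bandLength Ω ^ n := by
  simp [measureReal_def, Measure.pi_univ, bandLength]

lemma measurable_sigmaMk (n : ℕ) : Measurable fun ω : Fin n → ℝ => (⟨n, ω⟩ : BosonConfig) :=
  measurable_iff_le_map.2 (iInf_le _ n)

lemma measurable_bosonConfig {β : Type*} [MeasurableSpace β] {F : BosonConfig → β}
    (hF : ∀ n, Measurable fun ω : Fin n → ℝ => F ⟨n, ω⟩) : Measurable F := fun _ hs =>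
  MeasurableSpace.measurableSet_iInf.2 fun n => hF n hs

section FockIntegral

variable {𝕜 : Type*} [RCLike 𝕜] {Ω : ℝ} {F : BosonConfig → 𝕜}

lemma integrable_fockMeasure (hF : Measurable F) {C r : ℝ} (hr : 0 ≤ r)
    (hr1 : bandLength Ω * r < 1) (hC : ∀ n ω, ‖F ⟨n, ω⟩‖ ≤ C * r ^ n) :
    Integrable F (fockMeasure Ω) := by
  have hsector (n : ℕ) : Integrable (fun ω : Fin n → ℝ => F ⟨n, ω⟩) (sectorMeasure Ω n) :=
    .of_bound (hF.comp (measurable_sigmaMk n)).aestronglyMeasurable (C * r ^ n)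
      (.of_forall fun ω => hC n ω)
  refine integrable_sum_measure (fun n => (integrable_map_measure hF.aestronglyMeasurable
    (measurable_sigmaMk n).aemeasurable).2 (hsector n)) ?_
  refine ((summable_geometric_of_lt_one (mul_nonneg (bandLength_nonneg Ω) hr) hr1).mul_left
    C).of_nonneg_of_le (fun n => integral_nonneg fun _ => norm_nonneg _) fun n => ?_
  rw [integral_map (measurable_sigmaMk n).aemeasurable hF.norm.aestronglyMeasurable]
  calc ∫ ω : Fin n → ℝ, ‖F ⟨n, ω⟩‖ ∂sectorMeasure Ω n
      ≤ ∫ _ : Fin n → ℝ, C * r ^ n ∂sectorMeasure Ω n :=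
        integral_mono (hsector n).norm (integrable_const _) (hC n)
    _ = C * (bandLength Ω * r) ^ n := by
        rw [integral_const, sectorMeasure_real_univ, smul_eq_mul, mul_pow]; ring

lemma hasSum_integral_fockMeasure (hm : Measurable F) (hF : Integrable F (fockMeasure Ω)) :
    HasSum (fun n => ∫ ω, F ⟨n, ω⟩ ∂sectorMeasure Ω n) (∫ x, F x ∂fockMeasure Ω) := by
  have hsum := hasSum_integral_measure hF
  simp only [integral_map (measurable_sigmaMk _).aemeasurable hm.aestronglyMeasurable] at hsum
  exact hsum

end FockIntegral

/-! ### Amplitude pairings -/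

/-- The integral of the product of a matrix entry of `Ψ` and a conjugated one of `Φ`; all the
sesquilinear quantities of the model are combinations of these. -/
def pairing (Ω : ℝ) (Φ Ψ : FockMap) (a c b d : Fin 2) : ℂ :=
  ∫ x : BosonConfig, Ψ x.1 x.2 a c * conj (Φ x.1 x.2 b d) ∂fockMeasure Ω

lemma conj_pairing (Ω : ℝ) (Φ Ψ : FockMap) (a c b d : Fin 2) :
    conj (pairing Ω Φ Ψ a c b d) = pairing Ω Ψ Φ b d a c := by
  simp only [pairing, ← integral_conj, map_mul, Complex.conj_conj, mul_comm]

section Pairing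

variable {Ψ Φ Ψ' Φ' : ℝ → FockMap}

lemma IsRapidFamily.exists_norm_mul_conj_le (hΨ : IsRapidFamily Ψ) (hΦ : IsRapidFamily Φ) (T : ℝ)
    {r : ℝ} (hr : 0 < r) :
    ∃ C, ∀ t, |t| ≤ T → ∀ n ω a c b d, ‖Ψ t n ω a c * conj (Φ t n ω b d)‖ ≤ C * r ^ n := by
  obtain ⟨C, hC0, hC⟩ := hΨ.exists_norm_le T hr
  obtain ⟨D, -, hD⟩ := hΦ.exists_norm_le T one_pos
  refine ⟨C * D, fun t ht n ω a c b d => ?_⟩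
  rw [norm_mul, RCLike.norm_conj, mul_right_comm]
  exact mul_le_mul (hC t ht n ω a c) (by simpa using hD t ht n ω b d) (norm_nonneg _)
    (by positivity)

lemma IsRapid.measurable_mul_conj {Ψ Φ : FockMap} (hΨ : IsRapid Ψ) (hΦ : IsRapid Φ)
    (a c b d : Fin 2) :
    Measurable fun x : BosonConfig => Ψ x.1 x.2 a c * conj (Φ x.1 x.2 b d) :=
  measurable_bosonConfig fun n => (hΨ.measurable 0 n a c).mul
    (Complex.continuous_conj.measurable.comp (hΦ.measurable 0 n b d))

lemma IsRapid.integrable_mul_conj {Ψ Φ : FockMap} (hΨ : IsRapid Ψ) (hΦ : IsRapid Φ) (Ω : ℝ)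
    (a c b d : Fin 2) :
    Integrable (fun x : BosonConfig => Ψ x.1 x.2 a c * conj (Φ x.1 x.2 b d)) (fockMeasure Ω) := by
  obtain ⟨r, hr, hr1⟩ := exists_pos_mul_lt one_pos (bandLength Ω)
  obtain ⟨C, hC⟩ := hΨ.exists_norm_mul_conj_le hΦ 0 hr
  exact integrable_fockMeasure (hΨ.measurable_mul_conj hΦ a c b d) hr.le hr1
    fun n ω => hC 0 (by simp) n ω a c b d

lemma IsRapid.hasSum_pairing {Ψ Φ : FockMap} (hΨ : IsRapid Ψ) (hΦ : IsRapid Φ) (Ω : ℝ)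
    (a c b d : Fin 2) :
    HasSum (fun n => ∫ ω, Ψ n ω a c * conj (Φ n ω b d) ∂sectorMeasure Ω n)
      (pairing Ω Φ Ψ a c b d) :=
  hasSum_integral_fockMeasure (hΨ.measurable_mul_conj hΦ a c b d)
    (hΨ.integrable_mul_conj hΦ Ω a c b d)

lemma hasDerivAt_pairing (hΨ : IsRapidFamily Ψ) (hΦ : IsRapidFamily Φ) (hΨ' : IsRapidFamily Ψ')
    (hΦ' : IsRapidFamily Φ')
    (hdΨ : ∀ t n ω a b, HasDerivAt (fun t => Ψ t n ω a b) (Ψ' t n ω a b) t)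
    (hdΦ : ∀ t n ω a b, HasDerivAt (fun t => Φ t n ω a b) (Φ' t n ω a b) t)
    (Ω t : ℝ) (a c b d : Fin 2) :
    HasDerivAt (fun t => pairing Ω (Φ t) (Ψ t) a c b d)
      (pairing Ω (Φ t) (Ψ' t) a c b d + pairing Ω (Φ' t) (Ψ t) a c b d) t := by
  obtain ⟨r, hr, hr1⟩ := exists_pos_mul_lt one_pos (bandLength Ω)
  obtain ⟨C, hC⟩ := hΨ'.exists_norm_mul_conj_le hΦ (|t| + 1) hr
  obtain ⟨D, hD⟩ := hΨ.exists_norm_mul_conj_le hΦ' (|t| + 1) hr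
  have hC0 : 0 ≤ C := by simpa using (norm_nonneg _).trans (hC t (by simp) 0 0 0 0 0 0)
  have hD0 : 0 ≤ D := by simpa using (norm_nonneg _).trans (hD t (by simp) 0 0 0 0 0 0)
  have hbound : Integrable (fun x : BosonConfig => (C + D) * r ^ x.1) (fockMeasure Ω) :=
    integrable_fockMeasure (measurable_bosonConfig fun n => measurable_const' fun _ _ => rfl)
      hr.le hr1 fun n ω => (Real.norm_of_nonneg (by positivity)).le
  have hint := fun s => (hΨ.isRapid s).integrable_mul_conj (hΦ.isRapid s) Ω a c b d
  have hint₁ := (hΨ'.isRapid t).integrable_mul_conj (hΦ.isRapid t) Ω a c b d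
  have hint₂ := (hΨ.isRapid t).integrable_mul_conj (hΦ'.isRapid t) Ω a c b d
  rw [pairing, pairing, ← integral_add hint₁ hint₂]
  refine (hasDerivAt_integral_of_dominated_loc_of_deriv_le (μ := fockMeasure Ω) (x₀ := t)
    (F := fun t (x : BosonConfig) => Ψ t x.1 x.2 a c * conj (Φ t x.1 x.2 b d))
    (F' := fun t x => Ψ' t x.1 x.2 a c * conj (Φ t x.1 x.2 b d) +
      Ψ t x.1 x.2 a c * conj (Φ' t x.1 x.2 b d))
    (Metric.ball_mem_nhds t one_pos) (.of_forall fun s => (hint s).1) (hint t)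
    (hint₁.add hint₂).1 (.of_forall fun x s hs => ?_) hbound (.of_forall fun x s _ => ?_)).2
  · have hsT : |s| ≤ |t| + 1 := by
      rw [Metric.mem_ball, Real.dist_eq] at hs
      linarith [abs_sub_abs_le_abs_sub s t]
    rw [add_mul]
    exact norm_add_le_of_le (hC s hsT _ _ _ _ _ _) (hD s hsT _ _ _ _ _ _)
  · exact (hdΨ s x.1 x.2 a c).mul (hdΦ s x.1 x.2 b d).star

end Pairing

/-! ### Adjointness of annihilation and creation -/

/-- The integrand that `⟨Φ, a(f) Ψ⟩` and `⟨a†(f) Φ, Ψ⟩` have in common, as a function of the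
frequency of the boson that `a(f)` absorbs and of the frequencies of the other bosons. -/
def ladderIntegrand (f : ℝ → ℂ) (Φ Ψ : FockMap) (n : ℕ) (a c b d : Fin 2)
    (p : ℝ × (Fin n → ℝ)) : ℂ :=
  Ψ (n + 1) (Fin.cons p.1 p.2) a c * (conj (f p.1) * conj (Φ n p.2 b d))

section Adjoint

variable {Ω M : ℝ} {f : ℝ → ℂ} {Ψ Φ : FockMap}

lemma integrable_ladderIntegrand (hf : IsBandLimited Ω M f) (hΨ : IsRapid Ψ) (hΦ : IsRapid Φ)
    (n : ℕ) (a c b d : Fin 2) :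
    Integrable (ladderIntegrand f Φ Ψ n a c b d) ((bandMeasure Ω).prod (sectorMeasure Ω n)) := by
  obtain ⟨C, hC0, hC⟩ := hΨ.exists_norm_le one_pos
  obtain ⟨D, -, hD⟩ := hΦ.exists_norm_le one_pos
  simp only [one_pow, mul_one] at hC hD
  have hmeas : Measurable (ladderIntegrand f Φ Ψ n a c b d) :=
    (hΨ.measurable_cons 0 n a c).mul ((hf.measurable_conj.comp measurable_fst).mul
      (Complex.continuous_conj.measurable.comp ((hΦ.measurable 0 n b d).comp measurable_snd)))
  refine .of_bound hmeas.aestronglyMeasurable (C * (M * D)) (.of_forall fun p => ?_)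
  rw [ladderIntegrand, norm_mul]
  exact mul_le_mul (hC _ _ a c) (hf.norm_conj_mul_le _ (by simpa using hD _ _ b d))
    (norm_nonneg _) hC0

lemma integral_annihilate_mul_conj (hf : IsBandLimited Ω M f) (hΨ : IsRapid Ψ) (hΦ : IsRapid Φ)
    (n : ℕ) (a c b d : Fin 2) :
    ∫ ω, annihilate f Ψ n ω a c * conj (Φ n ω b d) ∂sectorMeasure Ω n =
      (√(n + 1) : ℝ) * ∫ p, ladderIntegrand f Φ Ψ n a c b d p
        ∂((bandMeasure Ω).prod (sectorMeasure Ω n)) := by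
  rw [integral_prod_symm _ (integrable_ladderIntegrand hf hΨ hΦ n a c b d), ← integral_const_mul]
  refine integral_congr_ae (.of_forall fun ω => ?_)
  simp only [annihilate_apply hf, mul_assoc, ← integral_mul_const, ladderIntegrand]
  simp only [mul_left_comm]

lemma ladderIntegrand_piFinSuccAbove (hsymm : IsBosonic Ψ) (n : ℕ) (a c b d : Fin 2)
    (j : Fin (n + 1)) (ω : Fin (n + 1) → ℝ) :
    ladderIntegrand f Φ Ψ n a c b d (MeasurableEquiv.piFinSuccAbove (fun _ => ℝ) j ω) =
      Ψ (n + 1) ω a c * (conj (f (ω j)) * conj (Φ n (fun i => ω (j.succAbove i)) b d)) := by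
  have hfront : Ψ (n + 1) (Fin.cons (ω j) (j.removeNth ω)) = Ψ (n + 1) ω := by
    rw [Fin.cons_removeNth_eq_comp_cycleRange_symm, hsymm]
  change Ψ (n + 1) (Fin.cons (ω j) (j.removeNth ω)) a c * _ = _
  rw [hfront]
  rfl

lemma integral_mul_conj_create (hf : IsBandLimited Ω M f) (hΨ : IsRapid Ψ) (hΦ : IsRapid Φ)
    (hsymm : IsBosonic Ψ) (n : ℕ) (a c b d : Fin 2) :
    ∫ ω, Ψ (n + 1) ω a c * conj (create f Φ (n + 1) ω b d) ∂sectorMeasure Ω (n + 1) =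
      (√(n + 1) : ℝ) * ∫ p, ladderIntegrand f Φ Ψ n a c b d p
        ∂((bandMeasure Ω).prod (sectorMeasure Ω n)) := by
  have hmp := measurePreserving_piFinSuccAbove (fun _ : Fin (n + 1) => bandMeasure Ω)
  have hexpand (ω : Fin (n + 1) → ℝ) : Ψ (n + 1) ω a c * conj (create f Φ (n + 1) ω b d) =
      ((1 / √(n + 1) : ℝ) : ℂ) * ∑ j, ladderIntegrand f Φ Ψ n a c b d
        (MeasurableEquiv.piFinSuccAbove (fun _ => ℝ) j ω) := by
    simp only [ladderIntegrand_piFinSuccAbove hsymm, ← Finset.mul_sum]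
    rw [create_succ_apply, map_mul, map_sum, Complex.conj_ofReal, mul_left_comm]
    simp only [map_mul]
  simp only [hexpand]
  have hint (j : Fin (n + 1)) : Integrable (fun ω => ladderIntegrand f Φ Ψ n a c b d
      (MeasurableEquiv.piFinSuccAbove (fun _ => ℝ) j ω)) (sectorMeasure Ω (n + 1)) :=
    (hmp j).integrable_comp_of_integrable (integrable_ladderIntegrand hf hΨ hΦ n a c b d)
  rw [integral_const_mul, integral_finsetSum _ fun j _ => hint j]
  simp only [(hmp _).integral_comp', Finset.sum_const, Finset.card_univ, Fintype.card_fin,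
    nsmul_eq_mul]
  have hcoeff : ((1 / √(n + 1) : ℝ) : ℂ) * ((n + 1 : ℕ) : ℂ) = (√(n + 1) : ℝ) := by
    rw [← Complex.ofReal_natCast, ← Complex.ofReal_mul, one_div_mul_eq_div, Nat.cast_add_one,
      Real.div_sqrt]
  rw [← mul_assoc, hcoeff]

lemma pairing_annihilate (hf : IsBandLimited Ω M f) (hΨ : IsRapid Ψ) (hΦ : IsRapid Φ)
    (hsymm : IsBosonic Ψ) (a c b d : Fin 2) :
    pairing Ω Φ (annihilate f Ψ) a c b d = pairing Ω (create f Φ) Ψ a c b d := by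
  have hA : IsRapid (annihilate f Ψ) := hΨ.annihilate hf.isBandFamily
  have hB : IsRapid (create f Φ) := hΦ.create hf.isBandFamily
  have hleft := hA.hasSum_pairing hΦ Ω a c b d
  have hright := (hasSum_nat_add_iff' 1).2 (hΨ.hasSum_pairing hB Ω a c b d)
  simp only [Finset.range_one, Finset.sum_singleton, create_zero_apply, Matrix.zero_apply,
    map_zero, mul_zero, integral_zero, sub_zero,
    integral_mul_conj_create hf hΨ hΦ hsymm] at hright
  simp only [integral_annihilate_mul_conj hf hΨ hΦ] at hleft
  exact hleft.unique hright

lemma pairing_create (hf : IsBandLimited Ω M f) (hΨ : IsRapid Ψ) (hΦ : IsRapid Φ)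
    (hsymm : IsBosonic Φ) (a c b d : Fin 2) :
    pairing Ω Φ (create f Ψ) a c b d = pairing Ω (annihilate f Φ) Ψ a c b d := by
  rw [← conj_pairing, ← pairing_annihilate hf hΦ hΨ hsymm, conj_pairing]

end Adjoint

/-! ### The inner product of the initial state -/

/-- The inner product `tr (Ψ (ρ ⊗ 1) Φ†)` of `Φ` and `Ψ` with respect to the initial state `ρ`. -/
def fockForm (Ω : ℝ) (ρ : Matrix (Fin 2) (Fin 2) ℂ) (Φ Ψ : FockMap) : ℂ :=
  ∫ x : BosonConfig, (Ψ x.1 x.2 * ρ * (Φ x.1 x.2).conjTranspose).trace ∂fockMeasure Ω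

/-- The squared norm of the inner product `fockForm`. -/
def fockNormSq (Ω : ℝ) (ρ : Matrix (Fin 2) (Fin 2) ℂ) (Ψ : FockMap) : ℝ := (fockForm Ω ρ Ψ Ψ).re

lemma mul_mul_conjTranspose_apply (A ρ B : Matrix (Fin 2) (Fin 2) ℂ) (a b : Fin 2) :
    (A * ρ * B.conjTranspose) a b = ∑ c, ∑ d, ρ c d * (A a c * conj (B b d)) := by
  simp only [Matrix.mul_apply, Fin.sum_univ_two, Matrix.conjTranspose_apply, RCLike.star_def]
  ring

section FockForm

variable {Ω : ℝ} {ρ : Matrix (Fin 2) (Fin 2) ℂ} {Ψ Φ X : FockMap}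

lemma integrable_mul_mul_conjTranspose (hΨ : IsRapid Ψ) (hΦ : IsRapid Φ) (Ω : ℝ)
    (ρ : Matrix (Fin 2) (Fin 2) ℂ) (a b : Fin 2) :
    Integrable (fun x : BosonConfig => (Ψ x.1 x.2 * ρ * (Φ x.1 x.2).conjTranspose) a b)
      (fockMeasure Ω) := by
  simp only [mul_mul_conjTranspose_apply]
  exact integrable_finsetSum _ fun c _ => integrable_finsetSum _ fun d _ =>
    (hΨ.integrable_mul_conj hΦ Ω a c b d).const_mul _

lemma integrable_trace (hΨ : IsRapid Ψ) (hΦ : IsRapid Φ) (Ω : ℝ)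
    (ρ : Matrix (Fin 2) (Fin 2) ℂ) :
    Integrable (fun x : BosonConfig => (Ψ x.1 x.2 * ρ * (Φ x.1 x.2).conjTranspose).trace)
      (fockMeasure Ω) := by
  simp only [Matrix.trace, Matrix.diag_apply]
  exact integrable_finsetSum _ fun a _ => integrable_mul_mul_conjTranspose hΨ hΦ Ω ρ a a

lemma fockForm_eq_sum (hΨ : IsRapid Ψ) (hΦ : IsRapid Φ) :
    fockForm Ω ρ Φ Ψ = ∑ a, ∑ c, ∑ d, ρ c d * pairing Ω Φ Ψ a c a d := by
  have hint (a c d : Fin 2) := (hΨ.integrable_mul_conj hΦ Ω a c a d).const_mul (ρ c d)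
  simp only [fockForm, pairing, Matrix.trace, Matrix.diag_apply, mul_mul_conjTranspose_apply,
    ← integral_const_mul]
  rw [integral_finsetSum _ fun a _ => integrable_finsetSum _ fun c _ =>
    integrable_finsetSum _ fun d _ => hint a c d]
  refine Finset.sum_congr rfl fun a _ => ?_
  rw [integral_finsetSum _ fun c _ => integrable_finsetSum _ fun d _ => hint a c d]
  exact Finset.sum_congr rfl fun c _ => integral_finsetSum _ fun d _ => hint a c d

lemma fockForm_add_right (hΨ : IsRapid Ψ) (hΦ : IsRapid Φ) (hX : IsRapid X) :
    fockForm Ω ρ Φ (Ψ + X) = fockForm Ω ρ Φ Ψ + fockForm Ω ρ Φ X := by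
  simp only [fockForm, Pi.add_apply, add_mul, Matrix.trace_add]
  exact integral_add (integrable_trace hΨ hΦ Ω ρ) (integrable_trace hX hΦ Ω ρ)

lemma fockForm_smul_right (c : ℂ) : fockForm Ω ρ Φ (c • Ψ) = c * fockForm Ω ρ Φ Ψ := by
  simp only [fockForm, Pi.smul_apply, Matrix.smul_mul, Matrix.trace_smul, smul_eq_mul,
    integral_const_mul]

lemma conj_fockForm (hρ : ρ.IsHermitian) : conj (fockForm Ω ρ Φ Ψ) = fockForm Ω ρ Ψ Φ := by
  rw [fockForm, ← integral_conj, fockForm]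
  refine integral_congr_ae (.of_forall fun x => ?_)
  simp only [starRingEnd_apply, ← Matrix.trace_conjTranspose, Matrix.conjTranspose_mul,
    Matrix.conjTranspose_conjTranspose, hρ.eq, mul_assoc]

lemma fockForm_add_left (hρ : ρ.IsHermitian) (hΨ : IsRapid Ψ) (hΦ : IsRapid Φ) (hX : IsRapid X) :
    fockForm Ω ρ (Φ + X) Ψ = fockForm Ω ρ Φ Ψ + fockForm Ω ρ X Ψ := by
  rw [← conj_fockForm hρ, fockForm_add_right hΦ hΨ hX, map_add, conj_fockForm hρ, conj_fockForm hρ]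

lemma fockForm_smul_left (hρ : ρ.IsHermitian) (c : ℂ) :
    fockForm Ω ρ (c • Φ) Ψ = conj c * fockForm Ω ρ Φ Ψ := by
  rw [← conj_fockForm hρ, fockForm_smul_right, map_mul, conj_fockForm hρ]

lemma fockForm_matrix_smul {K : Matrix (Fin 2) (Fin 2) ℂ} (hK : K.IsHermitian) :
    fockForm Ω ρ Φ (K • Ψ) = fockForm Ω ρ (K • Φ) Ψ := by
  refine integral_congr_ae (.of_forall fun x => ?_)
  simp only [Pi.smul_apply, smul_eq_mul, Matrix.conjTranspose_mul, hK.eq]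
  rw [Matrix.mul_assoc, Matrix.mul_assoc, Matrix.trace_mul_comm]
  simp only [Matrix.mul_assoc]

lemma fockForm_create {M : ℝ} {f : ℝ → ℂ} (hf : IsBandLimited Ω M f) (hΨ : IsRapid Ψ)
    (hΦ : IsRapid Φ) (hsymm : IsBosonic Φ) :
    fockForm Ω ρ Φ (create f Ψ) = fockForm Ω ρ (annihilate f Φ) Ψ := by
  rw [fockForm_eq_sum (hΨ.create hf.isBandFamily) hΦ,
    fockForm_eq_sum hΨ (hΦ.annihilate hf.isBandFamily)]
  simp only [pairing_create hf hΨ hΦ hsymm]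

lemma isHermitian_σx : σx.IsHermitian := by
  ext a b
  fin_cases a <;> fin_cases b <;> simp [σx]

lemma isHermitian_σz : σz.IsHermitian := by
  ext a b
  fin_cases a <;> fin_cases b <;> simp [σz]

lemma σx_mul_σx : σx * σx = 1 := by
  ext a b
  fin_cases a <;> fin_cases b <;> simp [σx]

lemma σz_mul_σz : σz * σz = 1 := by
  ext a b
  fin_cases a <;> fin_cases b <;> simp [σz]

lemma isHermitian_systemHamiltonian (ω₀ δ : ℝ) : (systemHamiltonian ω₀ δ).IsHermitian := by
  ext a b
  fin_cases a <;> fin_cases b <;> simp [systemHamiltonian, σx, σz]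

lemma im_fockForm_hamiltonian {M t : ℝ} {J : ℝ → ℝ} (hf : IsBandLimited Ω M (coupling J t))
    (hΨ : IsRapid Ψ) (hsymm : IsBosonic Ψ) (hρ : ρ.IsHermitian) (ω₀ δ : ℝ) :
    (fockForm Ω ρ Ψ (hamiltonian ω₀ δ J t Ψ)).im = 0 := by
  have hA : IsRapid (annihilate (coupling J t) Ψ) := hΨ.annihilate hf.isBandFamily
  have hC : IsRapid (create (coupling J t) Ψ) := hΨ.create hf.isBandFamily
  have hX : IsRapid (σx • Ψ) := hΨ.matrix_smul σx
  have hsplit : fockForm Ω ρ Ψ (hamiltonian ω₀ δ J t Ψ) =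
      fockForm Ω ρ Ψ (systemHamiltonian ω₀ δ • Ψ) +
      (fockForm Ω ρ (σx • Ψ) (annihilate (coupling J t) Ψ) +
      fockForm Ω ρ (σx • Ψ) (create (coupling J t) Ψ)) := by
    rw [← fockForm_add_right hA hX hC, ← fockForm_matrix_smul isHermitian_σx]
    exact fockForm_add_right (hΨ.matrix_smul _) hΨ ((hA.add hC).matrix_smul _)
  have hcreate : fockForm Ω ρ (σx • Ψ) (create (coupling J t) Ψ) =
      conj (fockForm Ω ρ (σx • Ψ) (annihilate (coupling J t) Ψ)) := by
    rw [conj_fockForm hρ, fockForm_create hf hΨ hX (hsymm.matrix_smul _),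
      fockForm_matrix_smul isHermitian_σx, annihilate_matrix_smul hf hΨ]
  have hsystem : conj (fockForm Ω ρ Ψ (systemHamiltonian ω₀ δ • Ψ)) =
      fockForm Ω ρ Ψ (systemHamiltonian ω₀ δ • Ψ) := by
    rw [conj_fockForm hρ, fockForm_matrix_smul (isHermitian_systemHamiltonian ω₀ δ)]
  rw [hsplit, hcreate, Complex.add_im, Complex.add_im, Complex.conj_im,
    Complex.conj_eq_iff_im.1 hsystem]
  ring

lemma re_trace_nonneg (hρ : ρ.PosSemidef) (A : Matrix (Fin 2) (Fin 2) ℂ) :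
    0 ≤ (A * ρ * A.conjTranspose).trace.re :=
  (Complex.le_def.1 (hρ.mul_mul_conjTranspose_same A).trace_nonneg).1

lemma fockNormSq_eq_integral (hΨ : IsRapid Ψ) :
    fockNormSq Ω ρ Ψ = ∫ x : BosonConfig,
      (Ψ x.1 x.2 * ρ * (Ψ x.1 x.2).conjTranspose).trace.re ∂fockMeasure Ω :=
  (integral_re (integrable_trace hΨ hΨ Ω ρ)).symm

lemma fockNormSq_nonneg (hρ : ρ.PosSemidef) (hΨ : IsRapid Ψ) : 0 ≤ fockNormSq Ω ρ Ψ := by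
  rw [fockNormSq_eq_integral hΨ]
  exact integral_nonneg fun x => re_trace_nonneg hρ _

lemma fockNormSq_add (hρ : ρ.IsHermitian) (hΨ : IsRapid Ψ) (hΦ : IsRapid Φ) :
    fockNormSq Ω ρ (Φ + Ψ) =
      fockNormSq Ω ρ Φ + 2 * (fockForm Ω ρ Φ Ψ).re + fockNormSq Ω ρ Ψ := by
  have hsum : IsRapid (Φ + Ψ) := hΦ.add hΨ
  rw [fockNormSq, fockForm_add_right hΦ hsum hΨ, fockForm_add_left hρ hΦ hΦ hΨ,
    fockForm_add_left hρ hΨ hΦ hΨ, ← conj_fockForm hρ (Φ := Φ) (Ψ := Ψ)]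
  simp only [Complex.add_re, Complex.conj_re, fockNormSq]
  ring

lemma fockNormSq_smul (hρ : ρ.IsHermitian) (c : ℂ) :
    fockNormSq Ω ρ (c • Ψ) = ‖c‖ ^ 2 * fockNormSq Ω ρ Ψ := by
  rw [fockNormSq, fockForm_smul_right, fockForm_smul_left hρ, ← mul_assoc, Complex.mul_conj,
    Complex.re_ofReal_mul, Complex.normSq_eq_norm_sq, fockNormSq]

lemma abs_re_fockForm_le (hρ : ρ.PosSemidef) (hΨ : IsRapid Ψ) (hΦ : IsRapid Φ) :
    |(fockForm Ω ρ Φ Ψ).re| ≤ √(fockNormSq Ω ρ Φ) * √(fockNormSq Ω ρ Ψ) := by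
  have hdiscrim : discrim (fockNormSq Ω ρ Ψ) (2 * (fockForm Ω ρ Φ Ψ).re) (fockNormSq Ω ρ Φ) ≤ 0 :=
    discrim_le_zero fun s => by
      have hS : IsRapid ((s : ℂ) • Ψ) := hΨ.smul s
      have hnonneg := fockNormSq_nonneg (Ω := Ω) hρ (hΦ.add hS)
      rw [fockNormSq_add hρ.1 hS hΦ, fockNormSq_smul hρ.1, fockForm_smul_right,
        Complex.re_ofReal_mul, Complex.norm_real, Real.norm_eq_abs, sq_abs] at hnonneg
      linarith
  rw [← Real.sqrt_mul (fockNormSq_nonneg hρ hΦ)]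
  refine Real.abs_le_sqrt ?_
  rw [discrim] at hdiscrim
  linarith

lemma fockNormSq_matrix_smul {K : Matrix (Fin 2) (Fin 2) ℂ} (hK : K.IsHermitian)
    (hK2 : K * K = 1) : fockNormSq Ω ρ (K • Ψ) = fockNormSq Ω ρ Ψ := by
  rw [fockNormSq, ← fockForm_matrix_smul hK, smul_smul, hK2, one_smul, fockNormSq]

end FockForm

/-! ### Energy estimates -/

/-- The interaction-picture Schrödinger equation `Ψ' = -i H_J(t) Ψ + R` with source `R`, as an
ordinary differential equation for each amplitude. -/
def SolvesSchrodinger (ω₀ δ : ℝ) (J : ℝ → ℝ) (R Ψ : ℝ → FockMap) : Prop :=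
  ∀ t n ω a b, HasDerivAt (fun t => Ψ t n ω a b)
    ((-Complex.I • hamiltonian ω₀ δ J t (Ψ t) + R t) n ω a b) t

section Energy

variable {Ω M ω₀ δ : ℝ} {ρ : Matrix (Fin 2) (Fin 2) ℂ} {J : ℝ → ℝ} {Ψ Ψ' R : ℝ → FockMap}

lemma hasDerivAt_fockNormSq (hρ : ρ.IsHermitian) (hΨ : IsRapidFamily Ψ) (hΨ' : IsRapidFamily Ψ')
    (hd : ∀ t n ω a b, HasDerivAt (fun t => Ψ t n ω a b) (Ψ' t n ω a b) t) (Ω t : ℝ) :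
    HasDerivAt (fun t => fockNormSq Ω ρ (Ψ t)) (2 * (fockForm Ω ρ (Ψ t) (Ψ' t)).re) t := by
  have hform : HasDerivAt (fun t => fockForm Ω ρ (Ψ t) (Ψ t))
      (fockForm Ω ρ (Ψ t) (Ψ' t) + fockForm Ω ρ (Ψ' t) (Ψ t)) t := by
    simp only [fun t => fockForm_eq_sum (Ω := Ω) (ρ := ρ) (hΨ.isRapid t) (hΨ.isRapid t),
      fockForm_eq_sum (hΨ'.isRapid t) (hΨ.isRapid t),
      fockForm_eq_sum (hΨ.isRapid t) (hΨ'.isRapid t), ← Finset.sum_add_distrib, ← mul_add]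
    exact HasDerivAt.fun_sum fun a _ => HasDerivAt.fun_sum fun c _ => HasDerivAt.fun_sum fun d _ =>
      (hasDerivAt_pairing hΨ hΨ hΨ' hΨ' hd hd Ω t a c a d).const_mul _
  refine (Complex.reCLM.hasFDerivAt.comp_hasDerivAt t hform).congr_deriv ?_
  rw [← conj_fockForm hρ (Φ := Ψ t), Complex.reCLM_apply, Complex.add_re, Complex.conj_re, two_mul]

lemma SolvesSchrodinger.hasDerivAt_fockNormSq (hd : SolvesSchrodinger ω₀ δ J R Ψ)
    (hf : IsBandFamily Ω M (coupling J)) (hρ : ρ.IsHermitian) (hΨ : IsRapidFamily Ψ)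
    (hR : IsRapidFamily R) (hsymm : ∀ t, IsBosonic (Ψ t)) (t : ℝ) :
    HasDerivAt (fun t => fockNormSq Ω ρ (Ψ t)) (2 * (fockForm Ω ρ (Ψ t) (R t)).re) t := by
  have hIH := (hΨ.hamiltonian hf ω₀ δ).smul (-Complex.I)
  have hskew : (-Complex.I * fockForm Ω ρ (Ψ t) (hamiltonian ω₀ δ J t (Ψ t))).re = 0 := by
    simp [im_fockForm_hamiltonian (hf.isBandLimited t) (hΨ.isRapid t) (hsymm t) hρ]
  refine (SpinBoson.hasDerivAt_fockNormSq hρ hΨ (hIH.add hR) hd Ω t).congr_deriv ?_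
  rw [fockForm_add_right (hIH.isRapid t) (hΨ.isRapid t) (hR.isRapid t), fockForm_smul_right,
    Complex.add_re, hskew, zero_add]

lemma sqrt_le_integral_of_deriv_le {N N' g : ℝ → ℝ} (hN : ∀ t, 0 ≤ N t) (hN0 : N 0 = 0)
    (hd : ∀ t, HasDerivAt N (N' t) t) (hg : Continuous g) (hg0 : ∀ t, 0 < t → 0 ≤ g t)
    (hb : ∀ t, 0 < t → N' t ≤ 2 * (√(N t) * g t)) {t : ℝ} (ht : 0 ≤ t) :
    √(N t) ≤ ∫ s in (0 : ℝ)..t, g s := by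
  -- The root is differentiable only where `N` is positive, so it is regularised by `ε ^ 2`.
  refine le_of_forall_pos_le_add fun ε hε => ?_
  have hpos (s : ℝ) : 0 < N s + ε ^ 2 := by have := hN s; positivity
  have hle (s : ℝ) : √(N s) ≤ √(N s + ε ^ 2) :=
    Real.sqrt_le_sqrt (le_add_of_nonneg_right (sq_nonneg ε))
  have hder (s : ℝ) : HasDerivAt (fun s => √(N s + ε ^ 2) - ∫ u in (0 : ℝ)..s, g u)
      (N' s / (2 * √(N s + ε ^ 2)) - g s) s :=
    (((hd s).add_const _).sqrt (hpos s).ne').sub (hg.integral_hasStrictDerivAt 0 s).hasDerivAt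
  have hanti : AntitoneOn (fun s => √(N s + ε ^ 2) - ∫ u in (0 : ℝ)..s, g u) (Set.Ici 0) := by
    refine antitoneOn_of_deriv_nonpos (convex_Ici 0)
      (fun s _ => (hder s).continuousAt.continuousWithinAt)
      (fun s _ => (hder s).differentiableAt.differentiableWithinAt) fun s hs => ?_
    rw [interior_Ici, Set.mem_Ioi] at hs
    have hroot : 0 < √(N s + ε ^ 2) := Real.sqrt_pos.2 (hpos s)
    rw [(hder s).deriv, sub_nonpos, div_le_iff₀ (by positivity)]
    linarith [hb s hs, mul_le_mul_of_nonneg_right (hle s) (hg0 s hs)]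
  have h0t := hanti Set.self_mem_Ici (Set.mem_Ici.2 ht) ht
  simp only [hN0, zero_add, intervalIntegral.integral_same, sub_zero, Real.sqrt_sq hε.le] at h0t
  linarith [hle t]

-- Duhamel's principle: the homogeneous evolution preserves the norm.
lemma SolvesSchrodinger.sqrt_fockNormSq_le_integral (hd : SolvesSchrodinger ω₀ δ J R Ψ)
    (hf : IsBandFamily Ω M (coupling J)) (hρ : ρ.PosSemidef) (hΨ : IsRapidFamily Ψ)
    (hR : IsRapidFamily R) (hsymm : ∀ t, IsBosonic (Ψ t)) (h0 : Ψ 0 = 0) {g : ℝ → ℝ}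
    (hg : Continuous g) (hRg : ∀ t, 0 < t → √(fockNormSq Ω ρ (R t)) ≤ g t) {t : ℝ} (ht : 0 ≤ t) :
    √(fockNormSq Ω ρ (Ψ t)) ≤ ∫ s in (0 : ℝ)..t, g s := by
  refine sqrt_le_integral_of_deriv_le (fun t => fockNormSq_nonneg hρ (hΨ.isRapid t))
    (by simp [fockNormSq, fockForm, h0]) (hd.hasDerivAt_fockNormSq hf hρ.1 hΨ hR hsymm) hg
    (fun t ht => (Real.sqrt_nonneg _).trans (hRg t ht)) (fun t ht => ?_) ht
  calc 2 * (fockForm Ω ρ (Ψ t) (R t)).re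
      ≤ 2 * (√(fockNormSq Ω ρ (Ψ t)) * √(fockNormSq Ω ρ (R t))) := by
        gcongr
        exact (le_abs_self _).trans (abs_re_fockForm_le hρ (hR.isRapid t) (hΨ.isRapid t))
    _ ≤ 2 * (√(fockNormSq Ω ρ (Ψ t)) * g t) := by
        gcongr
        exact hRg t ht

end Energy

/-! ### Conservation of the norm -/

lemma fockNormSq_vacuum (Ω : ℝ) (ρ : Matrix (Fin 2) (Fin 2) ℂ) :
    fockNormSq Ω ρ vacuum = ρ.trace.re := by
  have hsectors := hasSum_integral_fockMeasure (Ω := Ω)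
    (F := fun x => (vacuum x.1 x.2 * ρ * (vacuum x.1 x.2).conjTranspose).trace)
    (measurable_bosonConfig fun n => measurable_const' fun _ _ => rfl)
    (integrable_trace isRapid_vacuum isRapid_vacuum Ω ρ)
  have hzero := hsectors.unique (hasSum_single 0 fun n hn => by simp [vacuum, hn])
  rw [fockNormSq, fockForm, hzero]
  simp [vacuum, measureReal_def]

section Conservation

variable {Ω M : ℝ} {J : ℝ → ℝ} {ρ : Matrix (Fin 2) (Fin 2) ℂ}

lemma solvesSchrodinger_evolved (hf : IsBandFamily Ω M (coupling J)) (ω₀ δ : ℝ) :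
    SolvesSchrodinger ω₀ δ J (fun _ => 0) (evolved ω₀ δ J) := fun t n ω a b =>
  (hasDerivAt_evolved hf ω₀ δ t n ω a b).congr_deriv (add_zero _).symm

lemma fockNormSq_evolved (hf : IsBandFamily Ω M (coupling J)) (ω₀ δ : ℝ)
    (hρ : IsDensityMatrix ρ) (t : ℝ) : fockNormSq Ω ρ (evolved ω₀ δ J t) = 1 := by
  have hψ := isRapidFamily_evolved hf ω₀ δ
  have hzero : IsRapid 0 := by simpa using (hψ.isRapid 0).smul 0
  have hd (t : ℝ) : HasDerivAt (fun t => fockNormSq Ω ρ (evolved ω₀ δ J t)) 0 t := by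
    simpa [fockForm] using (solvesSchrodinger_evolved hf ω₀ δ).hasDerivAt_fockNormSq hf hρ.1.1 hψ
      hzero (isBosonic_evolved ω₀ δ J) t
  rw [is_const_of_deriv_eq_zero (fun t => (hd t).differentiableAt) (fun t => (hd t).deriv) t 0,
    evolved_zero hf, fockNormSq_vacuum, hρ.2, Complex.one_re]

end Conservation

/-! ### Spectral densities on a band -/

/-- Nonnegative spectral densities bounded by `M ^ 2` that vanish outside `[0, Ω]`. -/
structure IsBandDensity (Ω M : ℝ) (J : ℝ → ℝ) : Prop where
  measurable : Measurable J
  nonneg : ∀ x, 0 ≤ J x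
  sqrt_le : ∀ x, √(J x) ≤ M
  eq_zero : ∀ x, x ∉ Set.Icc 0 Ω → J x = 0

/-- The part of a spectral density above the Nyquist frequency `π / Δt`, which `sampledSD` omits. -/
def unresolvedSD (J : ℝ → ℝ) (Δt : ℝ) : ℝ → ℝ := (Set.Ioi (Real.pi / Δt)).indicator J

lemma norm_exp_I_mul_mul (x t : ℝ) : ‖Complex.exp (Complex.I * x * t)‖ = 1 := by
  rw [mul_assoc, ← Complex.ofReal_mul, mul_comm, Complex.norm_exp_ofReal_mul_I]

lemma norm_mul_exp_neg_I_mul_mul {y : ℝ} (hy : 0 ≤ y) (x τ : ℝ) :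
    ‖(y : ℂ) * Complex.exp (-Complex.I * x * τ)‖ = y := by
  have hexp : -Complex.I * x * τ = Complex.I * x * (-τ : ℝ) := by push_cast; ring
  rw [hexp, norm_mul, norm_exp_I_mul_mul, Complex.norm_of_nonneg hy, mul_one]

lemma coupling_indicator (s : Set ℝ) (J : ℝ → ℝ) (t : ℝ) :
    coupling (s.indicator J) t = s.indicator (coupling J t) := by
  funext x
  by_cases hx : x ∈ s <;> simp [coupling, hx]

lemma conj_coupling_mul_coupling {J : ℝ → ℝ} {x : ℝ} (hx : 0 ≤ J x) (s t : ℝ) :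
    conj (coupling J s x) * coupling J t x =
      J x * Complex.exp (-Complex.I * x * ((s - t : ℝ) : ℂ)) := by
  have hroot : (√(J x) : ℂ) * √(J x) = J x := by
    rw [← Complex.ofReal_mul, Real.mul_self_sqrt hx]
  have hphase : conj (Complex.exp (Complex.I * x * s)) * Complex.exp (Complex.I * x * t) =
      Complex.exp (-Complex.I * x * ((s - t : ℝ) : ℂ)) := by
    rw [← Complex.exp_conj, ← Complex.exp_add]
    congr 1
    simp only [map_mul, Complex.conj_I, Complex.conj_ofReal, Complex.ofReal_sub]
    ring
  rw [coupling, coupling, map_mul, Complex.conj_ofReal, mul_mul_mul_comm, hroot, hphase]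

namespace IsBandDensity

variable {Ω M : ℝ} {J : ℝ → ℝ}

lemma isBandFamily (hJ : IsBandDensity Ω M J) : IsBandFamily Ω M (coupling J) where
  isBandLimited t :=
    { measurable := (Complex.measurable_ofReal.comp hJ.measurable.sqrt).mul (by fun_prop)
      norm_le x := by
        rw [coupling, norm_mul, norm_exp_I_mul_mul, mul_one,
          Complex.norm_of_nonneg (Real.sqrt_nonneg _)]
        exact hJ.sqrt_le x
      eq_zero x hx := by simp [coupling, hJ.eq_zero x hx] }
  continuous x := by
    unfold coupling
    fun_prop

lemma indicator (hJ : IsBandDensity Ω M J) {s : Set ℝ} (hs : MeasurableSet s) :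
    IsBandDensity Ω M (s.indicator J) where
  measurable := hJ.measurable.indicator hs
  nonneg x := Set.indicator_nonneg (fun _ _ => hJ.nonneg _) x
  sqrt_le x := (Real.sqrt_le_sqrt (Set.indicator_le_self' (fun _ _ => hJ.nonneg _) x)).trans
    (hJ.sqrt_le x)
  eq_zero x hx := by by_cases hxs : x ∈ s <;> simp [hxs, hJ.eq_zero x hx]

lemma sampled (hJ : IsBandDensity Ω M J) (Δt : ℝ) : IsBandDensity Ω M (sampledSD J Δt) :=
  hJ.indicator measurableSet_Iic

lemma unresolved (hJ : IsBandDensity Ω M J) (Δt : ℝ) : IsBandDensity Ω M (unresolvedSD J Δt) :=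
  hJ.indicator measurableSet_Ioi

lemma integrable (hJ : IsBandDensity Ω M J) : Integrable J := by
  have hband : IntegrableOn J (Set.Icc 0 Ω) := by
    refine Measure.integrableOn_of_bounded (M := M ^ 2) (by simp)
      hJ.measurable.aestronglyMeasurable (.of_forall fun x => ?_)
    rw [Real.norm_of_nonneg (hJ.nonneg x)]
    exact (Real.sqrt_le_left ((Real.sqrt_nonneg _).trans (hJ.sqrt_le x))).1 (hJ.sqrt_le x)
  exact (integrableOn_iff_integrable_of_support_subset fun x hx =>
    not_imp_comm.1 (hJ.eq_zero x) hx).1 hband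

lemma integrable_mul_exp (hJ : IsBandDensity Ω M J) (τ : ℝ) :
    Integrable fun ω : ℝ => (J ω : ℂ) * Complex.exp (-Complex.I * ω * τ) :=
  hJ.integrable.mono'
    ((Complex.measurable_ofReal.comp hJ.measurable).mul (by fun_prop)).aestronglyMeasurable
    (.of_forall fun x => (norm_mul_exp_neg_I_mul_mul (hJ.nonneg x) x τ).le)

lemma continuous_bathCorrelation (hJ : IsBandDensity Ω M J) : Continuous (bathCorrelation J) :=
  continuous_of_dominated (bound := J) (fun τ => (hJ.integrable_mul_exp τ).1)
    (fun τ => .of_forall fun x => (norm_mul_exp_neg_I_mul_mul (hJ.nonneg x) x τ).le) hJ.integrable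
    (.of_forall fun x => by fun_prop)

lemma continuous_correlationError (hJ : IsBandDensity Ω M J) (Δt : ℝ) :
    Continuous (correlationError J Δt) :=
  hJ.continuous_bathCorrelation.sub (hJ.sampled Δt).continuous_bathCorrelation

lemma correlationError_eq (hJ : IsBandDensity Ω M J) (Δt τ : ℝ) :
    correlationError J Δt τ = bathCorrelation (unresolvedSD J Δt) τ := by
  have hsplit (x : ℝ) : J x - sampledSD J Δt x = unresolvedSD J Δt x := by
    rw [sampledSD, unresolvedSD, ← Set.compl_Iic, Set.indicator_compl, Pi.sub_apply]
  simp only [correlationError, bathCorrelation]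
  rw [← integral_sub (hJ.integrable_mul_exp τ) ((hJ.sampled Δt).integrable_mul_exp τ)]
  simp only [← sub_mul, ← Complex.ofReal_sub, hsplit]

lemma bandInner_unresolved (hJ : IsBandDensity Ω M J) (Δt s t : ℝ) :
    bandInner Ω (coupling (unresolvedSD J Δt) s) (coupling J t) =
      correlationError J Δt (s - t) := by
  have hdiag (x : ℝ) : conj (coupling (unresolvedSD J Δt) s x) * coupling J t x =
      unresolvedSD J Δt x * Complex.exp (-Complex.I * x * ((s - t : ℝ) : ℂ)) := by
    rw [← conj_coupling_mul_coupling ((hJ.unresolved Δt).nonneg x), unresolvedSD,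
      coupling_indicator, coupling_indicator]
    by_cases hx : x ∈ Set.Ioi (Real.pi / Δt) <;> simp [hx]
  rw [hJ.correlationError_eq, bandInner, bathCorrelation]
  simp only [hdiag]
  exact setIntegral_eq_integral_of_forall_compl_eq_zero fun x hx => by
    simp [(hJ.unresolved Δt).eq_zero x hx]

end IsBandDensity

/-! ### The amplitude of an unresolved boson -/

lemma hasDerivAt_annihilate {Ω M : ℝ} {h : ℝ → ℂ} {Ψ Ψ' : ℝ → FockMap} (hh : IsBandLimited Ω M h)
    (hΨ : IsRapidFamily Ψ) (hΨ' : IsRapidFamily Ψ')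
    (hd : ∀ t n ω a b, HasDerivAt (fun t => Ψ t n ω a b) (Ψ' t n ω a b) t)
    (t : ℝ) (n : ℕ) (ω : Fin n → ℝ) (a b : Fin 2) :
    HasDerivAt (fun t => annihilate h (Ψ t) n ω a b) (annihilate h (Ψ' t) n ω a b) t := by
  simp only [annihilate_apply hh]
  refine HasDerivAt.const_mul _ ?_
  obtain ⟨C, -, hC⟩ := hΨ'.exists_norm_le (|t| + 1) one_pos
  refine (hasDerivAt_integral_of_dominated_loc_of_deriv_le (bound := fun _ => M * (C * 1 ^ (n + 1)))
    (Metric.ball_mem_nhds t one_pos)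
    (.of_forall fun u => ((hΨ.isRapid u).integrable_conj_mul_cons hh ω a b).1)
    ((hΨ.isRapid t).integrable_conj_mul_cons hh ω a b)
    ((hΨ'.isRapid t).integrable_conj_mul_cons hh ω a b).1
    (.of_forall fun x u hu => ?_) (integrable_const _)
    (.of_forall fun x u _ => (hd u _ _ a b).const_mul _)).2
  have hu' : |u| ≤ |t| + 1 := by
    rw [Metric.mem_ball, Real.dist_eq] at hu
    linarith [abs_sub_abs_le_abs_sub u t]
  exact hh.norm_conj_mul_le x (hC u hu' _ _ a b)

section Unresolved

variable {Ω M : ℝ} {J : ℝ → ℝ} {ρ : Matrix (Fin 2) (Fin 2) ℂ}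

-- Commuting `a(h)` past the Hamiltonian leaves only the contraction of `h` with the coupling.
lemma IsBandDensity.solvesSchrodinger_annihilate (hJ : IsBandDensity Ω M J) (ω₀ δ Δt τ : ℝ) :
    SolvesSchrodinger ω₀ δ J
      (fun t => (-Complex.I * correlationError J Δt (τ - t)) • σx • evolved ω₀ δ J t)
      fun t => annihilate (coupling (unresolvedSD J Δt) τ) (evolved ω₀ δ J t) := by
  intro t n ω a b
  have hf := hJ.isBandFamily
  have hh := (hJ.unresolved Δt).isBandFamily.isBandLimited τ
  have hψ := isRapidFamily_evolved hf ω₀ δ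
  refine (hasDerivAt_annihilate hh hψ ((hψ.hamiltonian hf ω₀ δ).smul (-Complex.I))
    (hasDerivAt_evolved hf ω₀ δ) t n ω a b).congr_deriv ?_
  rw [annihilate_smul, annihilate_hamiltonian hh (hf.isBandLimited t) (hψ.isRapid t)
    (isBosonic_evolved ω₀ δ J t), hJ.bandInner_unresolved, smul_add, smul_smul]

lemma IsBandDensity.sqrt_fockNormSq_annihilate_le (hJ : IsBandDensity Ω M J) (ω₀ δ Δt : ℝ)
    (hρ : IsDensityMatrix ρ) (τ : ℝ) {t : ℝ} (ht : 0 ≤ t) :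
    √(fockNormSq Ω ρ (annihilate (coupling (unresolvedSD J Δt) τ) (evolved ω₀ δ J t))) ≤
      ∫ s in (0 : ℝ)..t, ‖correlationError J Δt (τ - s)‖ := by
  have hf := hJ.isBandFamily
  have hh := (hJ.unresolved Δt).isBandFamily.isBandLimited τ
  have hψ := isRapidFamily_evolved hf ω₀ δ
  have hc : Continuous fun t => correlationError J Δt (τ - t) :=
    (hJ.continuous_correlationError Δt).comp (continuous_const.sub continuous_id)
  refine (hJ.solvesSchrodinger_annihilate ω₀ δ Δt τ).sqrt_fockNormSq_le_integral hf hρ.1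
    (hψ.annihilate hh.isBandFamily) ((hψ.matrix_smul σx).continuous_smul (continuous_const.mul hc))
    (fun t => (isBosonic_evolved ω₀ δ J t).annihilate _) ?_ hc.norm (fun t _ => ?_) ht
  · ext n ω a b
    rw [evolved_zero hf, annihilate_apply hh]
    simp [vacuum]
  · rw [fockNormSq_smul hρ.1.1, fockNormSq_matrix_smul isHermitian_σx σx_mul_σx,
      fockNormSq_evolved hf ω₀ δ hρ, mul_one, Real.sqrt_sq (norm_nonneg _), norm_mul, norm_neg,
      Complex.norm_I, one_mul]

end Unresolved

/-! ### Projection onto the resolved bosons -/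

/-- The projection onto the configurations without bosons of frequency above `Λ`. -/
def lowPass (Λ : ℝ) (Ψ : FockMap) : FockMap := fun n => (Set.Iic fun _ => Λ).indicator (Ψ n)

section LowPass

variable {Ω M Λ : ℝ} {f : ℝ → ℂ} {ρ : Matrix (Fin 2) (Fin 2) ℂ} {Ψ Φ : FockMap}

lemma lowPass_of_le {n : ℕ} {ω : Fin n → ℝ} (h : ∀ i, ω i ≤ Λ) (Ψ : FockMap) :
    lowPass Λ Ψ n ω = Ψ n ω := Set.indicator_of_mem (Set.mem_Iic.2 h) _

lemma lowPass_of_not {n : ℕ} {ω : Fin n → ℝ} (h : ¬ ∀ i, ω i ≤ Λ) (Ψ : FockMap) :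
    lowPass Λ Ψ n ω = 0 := Set.indicator_of_notMem (mt Set.mem_Iic.1 h) _

lemma lowPass_add (Λ : ℝ) (Ψ Φ : FockMap) : lowPass Λ (Ψ + Φ) = lowPass Λ Ψ + lowPass Λ Φ :=
  funext fun n => Set.indicator_add _ (Ψ n) (Φ n)

lemma lowPass_smul (Λ : ℝ) (c : ℂ) (Ψ : FockMap) : lowPass Λ (c • Ψ) = c • lowPass Λ Ψ :=
  funext fun n => Set.indicator_const_smul _ c (Ψ n)

lemma lowPass_matrix_smul (Λ : ℝ) (K : Matrix (Fin 2) (Fin 2) ℂ) (Ψ : FockMap) :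
    lowPass Λ (K • Ψ) = K • lowPass Λ Ψ :=
  funext fun n => Set.indicator_const_smul _ K (Ψ n)

lemma lowPass_vacuum (Λ : ℝ) : lowPass Λ vacuum = vacuum := by
  funext n ω
  by_cases hω : ∀ i, ω i ≤ Λ
  · exact lowPass_of_le hω _
  · have hn : n ≠ 0 := by
      rintro rfl
      exact hω fun i => i.elim0
    rw [lowPass_of_not hω, vacuum, if_neg hn]

lemma IsRapidFamily.lowPass {Ψ : ℝ → FockMap} (h : IsRapidFamily Ψ) (Λ : ℝ) :
    IsRapidFamily fun t => lowPass Λ (Ψ t) where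
  measurable t n a b := by
    convert (h.measurable t n a b).indicator (measurableSet_Iic (a := fun _ => Λ)) using 1
    funext ω
    by_cases hω : ω ∈ Set.Iic fun _ => Λ <;> simp [SpinBoson.lowPass, hω]
  continuous n ω a b := by
    by_cases hω : ∀ i, ω i ≤ Λ
    · simpa only [lowPass_of_le hω] using h.continuous n ω a b
    · simpa only [lowPass_of_not hω] using continuous_const
  bound T r hr := by
    obtain ⟨C, hC0, hC⟩ := h.exists_norm_le T hr
    refine ⟨C, fun t ht n ω a b => ?_⟩
    by_cases hω : ∀ i, ω i ≤ Λ
    · exact lowPass_of_le hω (Ψ t) ▸ hC t ht n ω a b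
    · rw [lowPass_of_not hω, Matrix.zero_apply, norm_zero]
      positivity

lemma IsBosonic.lowPass (h : IsBosonic Ψ) (Λ : ℝ) : IsBosonic (lowPass Λ Ψ) := by
  intro n π ω
  have hperm : (∀ i, (ω ∘ π) i ≤ Λ) ↔ ∀ i, ω i ≤ Λ :=
    ⟨fun h i => by simpa using h (π.symm i), fun h i => h (π i)⟩
  by_cases hω : ∀ i, ω i ≤ Λ
  · rw [lowPass_of_le hω, lowPass_of_le (hperm.2 hω), h]
  · rw [lowPass_of_not hω, lowPass_of_not (mt hperm.1 hω)]

lemma fockForm_eq_lowPass_add (hΨ : IsRapid Ψ) (hΦ : IsRapid Φ) (Ω Λ : ℝ)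
    (ρ : Matrix (Fin 2) (Fin 2) ℂ) :
    fockForm Ω ρ Φ Ψ = fockForm Ω ρ (lowPass Λ Φ) (lowPass Λ Ψ) +
      fockForm Ω ρ (Φ - lowPass Λ Φ) (Ψ - lowPass Λ Ψ) := by
  have hPΨ : IsRapid (lowPass Λ Ψ) := hΨ.lowPass Λ
  have hPΦ : IsRapid (lowPass Λ Φ) := hΦ.lowPass Λ
  rw [fockForm, fockForm, fockForm, ← integral_add (integrable_trace hPΨ hPΦ Ω ρ)
    (integrable_trace (hΨ.sub hPΨ) (hΦ.sub hPΦ) Ω ρ)]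
  refine integral_congr_ae (.of_forall fun x => ?_)
  by_cases hω : ∀ i, x.2 i ≤ Λ
  · simp [lowPass_of_le hω]
  · simp [lowPass_of_not hω]

lemma fockNormSq_eq_lowPass_add (hΨ : IsRapid Ψ) (Ω Λ : ℝ) (ρ : Matrix (Fin 2) (Fin 2) ℂ) :
    fockNormSq Ω ρ Ψ = fockNormSq Ω ρ (lowPass Λ Ψ) + fockNormSq Ω ρ (Ψ - lowPass Λ Ψ) :=
  congrArg Complex.re (fockForm_eq_lowPass_add hΨ hΨ Ω Λ ρ)

lemma fockNormSq_lowPass_le (hρ : ρ.PosSemidef) (hΨ : IsRapid Ψ) (Ω Λ : ℝ) :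
    fockNormSq Ω ρ (lowPass Λ Ψ) ≤ fockNormSq Ω ρ Ψ := by
  rw [fockNormSq_eq_lowPass_add hΨ Ω Λ]
  exact le_add_of_nonneg_right (fockNormSq_nonneg hρ (hΨ.sub (hΨ.lowPass Λ)))

lemma IsBandLimited.indicator (hf : IsBandLimited Ω M f) {s : Set ℝ} (hs : MeasurableSet s) :
    IsBandLimited Ω M (s.indicator f) where
  measurable := hf.measurable.indicator hs
  norm_le x := (norm_indicator_le_norm_self f x).trans (hf.norm_le x)
  eq_zero x hx := by by_cases hxs : x ∈ s <;> simp [hxs, hf.eq_zero x hx]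

lemma lowPass_create (Λ : ℝ) (f : ℝ → ℂ) (Ψ : FockMap) :
    lowPass Λ (create f Ψ) = create ((Set.Iic Λ).indicator f) (lowPass Λ Ψ) := by
  ext n ω a b
  cases n with
  | zero => rw [lowPass_of_le fun i => i.elim0]; rfl
  | succ n =>
    by_cases hω : ∀ i, ω i ≤ Λ
    · rw [lowPass_of_le hω, create_succ_apply, create_succ_apply]
      congr 1
      refine Finset.sum_congr rfl fun j _ => ?_
      rw [Set.indicator_of_mem (Set.mem_Iic.2 (hω j)), lowPass_of_le fun i => hω _]
    · rw [lowPass_of_not hω, create_succ_apply, Finset.sum_eq_zero, mul_zero, Matrix.zero_apply]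
      intro j _
      by_cases hj : ω j ≤ Λ
      · rw [lowPass_of_not, Matrix.zero_apply, mul_zero]
        exact fun hrest => hω ((Fin.forall_iff_succAbove j).2 ⟨hj, hrest⟩)
      · rw [Set.indicator_of_notMem (mt Set.mem_Iic.1 hj), zero_mul]

lemma lowPass_annihilate (hf : IsBandLimited Ω M f) (hΨ : IsRapid Ψ) (Λ : ℝ) :
    lowPass Λ (annihilate f Ψ) = annihilate ((Set.Iic Λ).indicator f) (lowPass Λ Ψ) +
      lowPass Λ (annihilate ((Set.Ioi Λ).indicator f) Ψ) := by
  have hlow := hf.indicator (measurableSet_Iic (a := Λ))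
  have hhigh := hf.indicator (measurableSet_Ioi (a := Λ))
  have hPΨ : IsRapid (lowPass Λ Ψ) := hΨ.lowPass Λ
  ext n ω a b
  have hcons (x : ℝ) : (∀ i, (Fin.cons x ω : Fin (n + 1) → ℝ) i ≤ Λ) ↔
      x ≤ Λ ∧ ∀ i, ω i ≤ Λ := by
    rw [Fin.forall_fin_succ]
    simp only [Fin.cons_zero, Fin.cons_succ]
  by_cases hω : ∀ i, ω i ≤ Λ
  · rw [Pi.add_apply, Pi.add_apply, Matrix.add_apply, lowPass_of_le hω, lowPass_of_le hω,
      annihilate_apply hf, annihilate_apply hlow, annihilate_apply hhigh, ← mul_add,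
      ← integral_add (hPΨ.integrable_conj_mul_cons hlow ω a b)
        (hΨ.integrable_conj_mul_cons hhigh ω a b)]
    congr 2
    funext x
    rcases le_or_gt x Λ with hx | hx
    · simp [lowPass_of_le ((hcons x).2 ⟨hx, hω⟩), hx]
    · simp [hx.not_ge, hx]
  · rw [Pi.add_apply, Pi.add_apply, lowPass_of_not hω, lowPass_of_not hω, add_zero,
      annihilate_apply hlow]
    simp [fun x => lowPass_of_not (fun h => hω ((hcons x).1 h).2) Ψ]

lemma lowPass_hamiltonian {J : ℝ → ℝ} {t : ℝ} (hf : IsBandLimited Ω M (coupling J t))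
    (hΨ : IsRapid Ψ) (ω₀ δ Δt : ℝ) :
    lowPass (Real.pi / Δt) (hamiltonian ω₀ δ J t Ψ) =
      hamiltonian ω₀ δ (sampledSD J Δt) t (lowPass (Real.pi / Δt) Ψ) +
        σx • lowPass (Real.pi / Δt) (annihilate (coupling (unresolvedSD J Δt) t) Ψ) := by
  have hdef (J : ℝ → ℝ) (Ψ : FockMap) : hamiltonian ω₀ δ J t Ψ =
      systemHamiltonian ω₀ δ • Ψ + σx • (annihilate (coupling J t) Ψ + create (coupling J t) Ψ) :=
    rfl
  rw [hdef, hdef, lowPass_add, lowPass_matrix_smul, lowPass_matrix_smul, lowPass_add,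
    lowPass_annihilate hf hΨ, lowPass_create, sampledSD, unresolvedSD, coupling_indicator,
    coupling_indicator]
  simp only [smul_add]
  abel

end LowPass

/-! ### The distance to the resolved evolution -/

section Distance

variable {Ω M : ℝ} {J : ℝ → ℝ} {ρ : Matrix (Fin 2) (Fin 2) ℂ} {Ψ Φ : FockMap}

lemma IsBosonic.sub (hΨ : IsBosonic Ψ) (hΦ : IsBosonic Φ) : IsBosonic (Ψ - Φ) := fun n π ω => by
  simp only [Pi.sub_apply, hΨ n π ω, hΦ n π ω]

lemma hamiltonian_add {t : ℝ} (hf : IsBandLimited Ω M (coupling J t)) (hΨ : IsRapid Ψ)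
    (hΦ : IsRapid Φ) (ω₀ δ : ℝ) :
    hamiltonian ω₀ δ J t (Ψ + Φ) = hamiltonian ω₀ δ J t Ψ + hamiltonian ω₀ δ J t Φ := by
  funext n ω
  simp only [hamiltonian, annihilate_add hf hΨ hΦ, create_add, Pi.add_apply, mul_add]
  abel

lemma hasDerivAt_lowPass {Ψ Ψ' : ℝ → FockMap}
    (hd : ∀ t n ω a b, HasDerivAt (fun t => Ψ t n ω a b) (Ψ' t n ω a b) t) (Λ t : ℝ) (n : ℕ)
    (ω : Fin n → ℝ) (a b : Fin 2) :
    HasDerivAt (fun t => lowPass Λ (Ψ t) n ω a b) (lowPass Λ (Ψ' t) n ω a b) t := by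
  by_cases hω : ∀ i, ω i ≤ Λ
  · simpa only [lowPass_of_le hω] using hd t n ω a b
  · simp only [lowPass_of_not hω]
    exact hasDerivAt_const t _

lemma continuous_integral_comp_sub {c : ℝ → ℝ} (hc : Continuous c) :
    Continuous fun t' : ℝ => ∫ t'' in (0 : ℝ)..t', c (t' - t'') := by
  simp only [intervalIntegral.integral_comp_sub_left, sub_self, sub_zero]
  exact intervalIntegral.continuous_primitive (fun a b => hc.intervalIntegrable a b) 0

-- The source is the absorption of an unresolved boson.
lemma IsBandDensity.solvesSchrodinger_lowPass_sub (hJ : IsBandDensity Ω M J) (ω₀ δ Δt : ℝ) :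
    SolvesSchrodinger ω₀ δ (sampledSD J Δt)
      (fun t => -Complex.I • σx • lowPass (Real.pi / Δt)
        (annihilate (coupling (unresolvedSD J Δt) t) (evolved ω₀ δ J t)))
      fun t => lowPass (Real.pi / Δt) (evolved ω₀ δ J t) - evolved ω₀ δ (sampledSD J Δt) t := by
  intro t n ω a b
  have hf := hJ.isBandFamily
  have hg := (hJ.sampled Δt).isBandFamily
  have hψ := (isRapidFamily_evolved hf ω₀ δ).isRapid t
  have hφ := (isRapidFamily_evolved hg ω₀ δ).isRapid t
  have hPψ : IsRapid (lowPass (Real.pi / Δt) (evolved ω₀ δ J t)) := hψ.lowPass _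
  have hsub := hamiltonian_add (hg.isBandLimited t) (hPψ.sub hφ) hφ ω₀ δ
  rw [sub_add_cancel] at hsub
  refine ((hasDerivAt_lowPass (Ψ' := fun t => -Complex.I • hamiltonian ω₀ δ J t (evolved ω₀ δ J t))
    (hasDerivAt_evolved hf ω₀ δ) _ t n ω a b).fun_sub
    (hasDerivAt_evolved hg ω₀ δ t n ω a b)).congr_deriv ?_
  rw [lowPass_smul, lowPass_hamiltonian (hf.isBandLimited t) hψ, hsub]
  simp only [Pi.add_apply, Pi.smul_apply, Matrix.add_apply, Matrix.smul_apply, smul_eq_mul]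
  ring

lemma IsBandDensity.sqrt_fockNormSq_lowPass_sub_le (hJ : IsBandDensity Ω M J) (ω₀ δ Δt : ℝ)
    (hρ : IsDensityMatrix ρ) {t : ℝ} (ht : 0 ≤ t) :
    √(fockNormSq Ω ρ (lowPass (Real.pi / Δt) (evolved ω₀ δ J t) -
        evolved ω₀ δ (sampledSD J Δt) t)) ≤
      ∫ t' in (0 : ℝ)..t, ∫ t'' in (0 : ℝ)..t', ‖correlationError J Δt (t' - t'')‖ := by
  have hf := hJ.isBandFamily
  have hg := (hJ.sampled Δt).isBandFamily
  have hψ := isRapidFamily_evolved hf ω₀ δ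
  have hemit := hψ.annihilate (hJ.unresolved Δt).isBandFamily
  refine (hJ.solvesSchrodinger_lowPass_sub ω₀ δ Δt).sqrt_fockNormSq_le_integral hg hρ.1
    ((hψ.lowPass _).sub (isRapidFamily_evolved hg ω₀ δ))
    (((hemit.lowPass _).matrix_smul σx).smul (-Complex.I))
    (fun t => ((isBosonic_evolved ω₀ δ J t).lowPass _).sub (isBosonic_evolved ω₀ δ _ t))
    (by rw [evolved_zero hf, evolved_zero hg, lowPass_vacuum, sub_self])
    (continuous_integral_comp_sub (hJ.continuous_correlationError Δt).norm) (fun t ht => ?_) ht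
  rw [fockNormSq_smul hρ.1.1, fockNormSq_matrix_smul isHermitian_σx σx_mul_σx, norm_neg,
    Complex.norm_I, one_pow, one_mul]
  exact (Real.sqrt_le_sqrt (fockNormSq_lowPass_le hρ.1 (hemit.isRapid t) Ω _)).trans
    (hJ.sqrt_fockNormSq_annihilate_le ω₀ δ Δt hρ t ht.le)

end Distance

/-! ### Expectation values of nearby states -/

section Expectation

variable {Ω : ℝ} {ρ K : Matrix (Fin 2) (Fin 2) ℂ} {ψ φ : FockMap}

lemma fockForm_sub_left (hρ : ρ.IsHermitian) {X : FockMap} (hψ : IsRapid ψ) (hφ : IsRapid φ)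
    (hX : IsRapid X) : fockForm Ω ρ (ψ - φ) X = fockForm Ω ρ ψ X - fockForm Ω ρ φ X := by
  rw [eq_sub_iff_add_eq, ← fockForm_add_left hρ hX (hψ.sub hφ) hφ, sub_add_cancel]

lemma re_fockForm_sub_add (hρ : ρ.IsHermitian) (hψ : IsRapid ψ) (hφ : IsRapid φ)
    (hK : K.IsHermitian) :
    (fockForm Ω ρ (ψ - φ) (K • (ψ + φ))).re =
      (fockForm Ω ρ ψ (K • ψ)).re - (fockForm Ω ρ φ (K • φ)).re := by
  have hKψ : IsRapid (K • ψ) := hψ.matrix_smul K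
  have hKφ : IsRapid (K • φ) := hφ.matrix_smul K
  have hcross : fockForm Ω ρ φ (K • ψ) = conj (fockForm Ω ρ ψ (K • φ)) := by
    rw [conj_fockForm hρ, fockForm_matrix_smul hK]
  rw [smul_add, fockForm_add_right hKψ (hψ.sub hφ) hKφ, fockForm_sub_left hρ hψ hφ hKψ,
    fockForm_sub_left hρ hψ hφ hKφ, hcross]
  simp only [Complex.add_re, Complex.sub_re, Complex.conj_re]
  ring

lemma sqrt_fockNormSq_add_le_two (hρ : ρ.PosSemidef) (hψ : IsRapid ψ) (hφ : IsRapid φ)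
    (hψ1 : fockNormSq Ω ρ ψ ≤ 1) (hφ1 : fockNormSq Ω ρ φ ≤ 1) :
    √(fockNormSq Ω ρ (ψ + φ)) ≤ 2 := by
  have hcross : (fockForm Ω ρ ψ φ).re ≤ 1 :=
    calc (fockForm Ω ρ ψ φ).re ≤ √(fockNormSq Ω ρ ψ) * √(fockNormSq Ω ρ φ) :=
          (le_abs_self _).trans (abs_re_fockForm_le hρ hφ hψ)
      _ ≤ 1 := mul_le_one₀ (Real.sqrt_le_one.2 hψ1) (Real.sqrt_nonneg _) (Real.sqrt_le_one.2 hφ1)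
  rw [Real.sqrt_le_left two_pos.le, fockNormSq_add hρ.1 hφ hψ]
  linarith

-- `⟨ψ, Kψ⟩ - ⟨φ, Kφ⟩ = Re ⟨ψ - φ, K(ψ + φ)⟩`, and `K` is an isometry.
lemma abs_re_fockForm_sub_le (hρ : ρ.PosSemidef) (hψ : IsRapid ψ) (hφ : IsRapid φ)
    (hψ1 : fockNormSq Ω ρ ψ ≤ 1) (hφ1 : fockNormSq Ω ρ φ ≤ 1) (hK : K.IsHermitian)
    (hK2 : K * K = 1) :
    |(fockForm Ω ρ ψ (K • ψ)).re - (fockForm Ω ρ φ (K • φ)).re| ≤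
      2 * √(fockNormSq Ω ρ (ψ - φ)) := by
  have hS : IsRapid (K • (ψ + φ)) := (hψ.add hφ).matrix_smul K
  rw [← re_fockForm_sub_add hρ.1 hψ hφ hK]
  refine (abs_re_fockForm_le hρ hS (hψ.sub hφ)).trans ?_
  rw [fockNormSq_matrix_smul hK hK2, mul_comm]
  gcongr
  exact sqrt_fockNormSq_add_le_two hρ hψ hφ hψ1 hφ1

-- The part of `ψ` above `Λ` is small too: both states have norm one, so its squared norm is the
-- norm defect `‖φ‖² - ‖Pψ‖²` of the projection.
lemma abs_re_fockForm_sub_le_lowPass (hρ : ρ.PosSemidef) (hψ : IsRapid ψ) (hφ : IsRapid φ)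
    (hψ1 : fockNormSq Ω ρ ψ = 1) (hφ1 : fockNormSq Ω ρ φ = 1) (Λ : ℝ) (hK : K.IsHermitian)
    (hK2 : K * K = 1) :
    |(fockForm Ω ρ ψ (K • ψ)).re - (fockForm Ω ρ φ (K • φ)).re| ≤
      4 * √(fockNormSq Ω ρ (lowPass Λ ψ - φ)) := by
  have hp : IsRapid (lowPass Λ ψ) := hψ.lowPass Λ
  have hq : IsRapid (ψ - lowPass Λ ψ) := hψ.sub hp
  have hp1 : fockNormSq Ω ρ (lowPass Λ ψ) ≤ 1 := hψ1 ▸ fockNormSq_lowPass_le hρ hψ Ω Λ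
  have hlow := abs_re_fockForm_sub_le hρ hp hφ hp1 hφ1.le hK hK2
  have hdefect := abs_re_fockForm_sub_le hρ hp hφ hp1 hφ1.le Matrix.isHermitian_one (one_mul 1)
  rw [one_smul, one_smul] at hdefect
  have hhigh : |(fockForm Ω ρ (ψ - lowPass Λ ψ) (K • (ψ - lowPass Λ ψ))).re| ≤
      fockNormSq Ω ρ φ - fockNormSq Ω ρ (lowPass Λ ψ) := by
    refine (abs_re_fockForm_le hρ (hq.matrix_smul K) hq).trans ?_
    rw [fockNormSq_matrix_smul hK hK2, Real.mul_self_sqrt (fockNormSq_nonneg hρ hq), hφ1, ← hψ1,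
      fockNormSq_eq_lowPass_add hψ Ω Λ, add_sub_cancel_left]
  have hKψ : IsRapid (K • ψ) := hψ.matrix_smul K
  rw [fockForm_eq_lowPass_add hKψ hψ Ω Λ, lowPass_matrix_smul, ← smul_sub, Complex.add_re]
  rw [fockNormSq, fockNormSq] at hhigh
  rw [abs_le] at hlow hdefect hhigh ⊢
  constructor <;> linarith [hlow.1, hlow.2, hdefect.1, hhigh.1, hhigh.2]

end Expectation

/-! ### The reduced state -/

/-- The partial trace `tr_F (Ψ ρ Ψ†)` over the bosons with frequencies in `[0, Ω]`. -/
def partialTrace (Ω : ℝ) (ρ : Matrix (Fin 2) (Fin 2) ℂ) (Ψ : FockMap) :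
    Matrix (Fin 2) (Fin 2) ℂ :=
  Matrix.of fun a b =>
    ∫ x : BosonConfig, (Ψ x.1 x.2 * ρ * (Ψ x.1 x.2).conjTranspose) a b ∂fockMeasure Ω

section PartialTrace

variable {Ω : ℝ} {ρ : Matrix (Fin 2) (Fin 2) ℂ} {Ψ : FockMap}

lemma trace_mul_partialTrace (hΨ : IsRapid Ψ) (Ω : ℝ) (ρ K : Matrix (Fin 2) (Fin 2) ℂ) :
    (K * partialTrace Ω ρ Ψ).trace = fockForm Ω ρ Ψ (K • Ψ) := by
  have hint (a b : Fin 2) :=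
    (integrable_mul_mul_conjTranspose hΨ hΨ Ω ρ b a).const_mul (K a b)
  simp only [fockForm, Pi.smul_apply, smul_eq_mul, Matrix.mul_assoc K, Matrix.trace,
    Matrix.diag_apply, Matrix.mul_apply (M := K), partialTrace, Matrix.of_apply,
    ← integral_const_mul]
  rw [integral_finsetSum _ fun a _ => integrable_finsetSum _ fun b _ => hint a b]
  exact Finset.sum_congr rfl fun a _ => (integral_finsetSum _ fun b _ => hint a b).symm

lemma trace_vecMulVec_star_mul (v : Fin 2 → ℂ) (A : Matrix (Fin 2) (Fin 2) ℂ) :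
    (Matrix.vecMulVec v (star v) * A).trace = star v ⬝ᵥ A.mulVec v := by
  rw [Matrix.trace_mul_comm, Matrix.mul_vecMulVec, Matrix.trace_vecMulVec, dotProduct_comm]

lemma posSemidef_partialTrace (hρ : ρ.PosSemidef) (hΨ : IsRapid Ψ) (Ω : ℝ) :
    (partialTrace Ω ρ Ψ).PosSemidef := by
  have hpos (x : BosonConfig) : (Ψ x.1 x.2 * ρ * (Ψ x.1 x.2).conjTranspose).PosSemidef :=
    hρ.mul_mul_conjTranspose_same _
  refine .of_dotProduct_mulVec_nonneg ?_ fun v => ?_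
  · ext a b
    rw [Matrix.conjTranspose_apply, partialTrace, Matrix.of_apply, Matrix.of_apply,
      RCLike.star_def, ← integral_conj]
    exact integral_congr_ae (.of_forall fun x => (hpos x).1.apply a b)
  · rw [← trace_vecMulVec_star_mul, trace_mul_partialTrace hΨ]
    refine integral_nonneg fun x => ?_
    simp only [Pi.smul_apply, smul_eq_mul, Matrix.mul_assoc (Matrix.vecMulVec v (star v)),
      trace_vecMulVec_star_mul]
    exact (hpos x).dotProduct_mulVec_nonneg v

end PartialTrace

section Reduced

variable {Ω M : ℝ} {J : ℝ → ℝ} {ρ : Matrix (Fin 2) (Fin 2) ℂ}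

lemma sectorMeasure_eq_restrict (Ω : ℝ) (n : ℕ) :
    sectorMeasure Ω n = volume.restrict (Set.univ.pi fun _ => Set.Icc 0 Ω) := by
  rw [volume_pi, Measure.restrict_pi_pi]
  rfl

lemma IsBandSupported.eq_zero_of_notMem_pi {Ψ : FockMap} (h : IsBandSupported Ω Ψ) {n : ℕ}
    {ω : Fin n → ℝ} (hω : ω ∉ Set.univ.pi fun _ => Set.Icc 0 Ω) : Ψ n ω = 0 := by
  simp only [Set.mem_univ_pi, not_forall] at hω
  exact hω.elim fun i hi => h n ω i hi

lemma IsRapid.measurable_mul_mul_conjTranspose {Ψ : FockMap} (hΨ : IsRapid Ψ)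
    (ρ : Matrix (Fin 2) (Fin 2) ℂ) (a b : Fin 2) :
    Measurable fun x : BosonConfig => (Ψ x.1 x.2 * ρ * (Ψ x.1 x.2).conjTranspose) a b := by
  simp only [mul_mul_conjTranspose_apply]
  exact Finset.measurable_fun_sum _ fun c _ => Finset.measurable_fun_sum _ fun d _ =>
    (hΨ.measurable_mul_conj hΨ a c b d).const_mul _

lemma integrable_sector (hf : IsBandFamily Ω M (coupling J)) (ω₀ δ t : ℝ)
    (ρ : Matrix (Fin 2) (Fin 2) ℂ) (n : ℕ) (a b : Fin 2) :
    Integrable fun ω : Fin n → ℝ =>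
      (evolved ω₀ δ J t n ω * ρ * (evolved ω₀ δ J t n ω).conjTranspose) a b := by
  have hψ := (isRapidFamily_evolved hf ω₀ δ).isRapid t
  have hfock := (integrable_mul_mul_conjTranspose hψ hψ Ω ρ a b).mono_measure (Measure.le_sum _ n)
  have hsector := (integrable_map_measure
    (hψ.measurable_mul_mul_conjTranspose ρ a b).aestronglyMeasurable
    (measurable_sigmaMk n).aemeasurable).1 hfock
  rw [sectorMeasure_eq_restrict] at hsector
  refine (integrableOn_iff_integrable_of_support_subset fun ω hω => ?_).1 hsector
  by_contra hout
  exact hω (by simp [(isBandSupported_evolved hf ω₀ δ t).eq_zero_of_notMem_pi hout])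

lemma sectorState_apply (hf : IsBandFamily Ω M (coupling J)) (ω₀ δ t : ℝ)
    (ρ : Matrix (Fin 2) (Fin 2) ℂ) (n : ℕ) (a b : Fin 2) :
    sectorState ω₀ δ J ρ t n a b = ∫ ω,
      (evolved ω₀ δ J t n ω * ρ * (evolved ω₀ δ J t n ω).conjTranspose) a b
        ∂sectorMeasure Ω n := by
  rw [sectorMeasure_eq_restrict, setIntegral_eq_integral_of_forall_compl_eq_zero]
  · rfl
  · intro ω hω
    simp [(isBandSupported_evolved hf ω₀ δ t).eq_zero_of_notMem_pi hω]

lemma hasSum_sectorState (hf : IsBandFamily Ω M (coupling J)) (ω₀ δ t : ℝ)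
    (ρ : Matrix (Fin 2) (Fin 2) ℂ) :
    HasSum (fun n => sectorState ω₀ δ J ρ t n) (partialTrace Ω ρ (evolved ω₀ δ J t)) := by
  have hψ := (isRapidFamily_evolved hf ω₀ δ).isRapid t
  refine Pi.hasSum.2 fun a => Pi.hasSum.2 fun b => ?_
  simp only [sectorState_apply hf]
  exact hasSum_integral_fockMeasure (hψ.measurable_mul_mul_conjTranspose ρ a b)
    (integrable_mul_mul_conjTranspose hψ hψ Ω ρ a b)

lemma reducedState_eq_partialTrace (hf : IsBandFamily Ω M (coupling J)) (ω₀ δ t : ℝ)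
    (ρ : Matrix (Fin 2) (Fin 2) ℂ) :
    reducedState ω₀ δ J ρ t = partialTrace Ω ρ (evolved ω₀ δ J t) :=
  (hasSum_sectorState hf ω₀ δ t ρ).tsum_eq

lemma expectSigmaZ_eq_fockForm (hf : IsBandFamily Ω M (coupling J)) (ω₀ δ t : ℝ)
    (ρ : Matrix (Fin 2) (Fin 2) ℂ) :
    expectSigmaZ ω₀ δ J ρ t = fockForm Ω ρ (evolved ω₀ δ J t) (σz • evolved ω₀ δ J t) := by
  rw [expectSigmaZ, reducedState_eq_partialTrace hf,
    trace_mul_partialTrace ((isRapidFamily_evolved hf ω₀ δ).isRapid t)]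

lemma im_fockForm_matrix_smul (hρ : ρ.IsHermitian) {K : Matrix (Fin 2) (Fin 2) ℂ}
    (hK : K.IsHermitian) (Ω : ℝ) (Ψ : FockMap) : (fockForm Ω ρ Ψ (K • Ψ)).im = 0 :=
  Complex.conj_eq_iff_im.1 (by rw [conj_fockForm hρ, fockForm_matrix_smul hK])

lemma isDensityMatrix_reducedState (hf : IsBandFamily Ω M (coupling J)) (ω₀ δ t : ℝ)
    (hρ : IsDensityMatrix ρ) : IsDensityMatrix (reducedState ω₀ δ J ρ t) := by
  have hψ := (isRapidFamily_evolved hf ω₀ δ).isRapid t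
  rw [reducedState_eq_partialTrace hf]
  refine ⟨posSemidef_partialTrace hρ.1 hψ Ω, ?_⟩
  have hreal := im_fockForm_matrix_smul hρ.1.1 Matrix.isHermitian_one Ω (evolved ω₀ δ J t)
  rw [← one_mul (partialTrace _ _ _), trace_mul_partialTrace hψ]
  rw [one_smul] at hreal ⊢
  exact Complex.ext (fockNormSq_evolved hf ω₀ δ hρ t) hreal

lemma evolutionWellDefined (hf : IsBandFamily Ω M (coupling J)) (ω₀ δ t : ℝ)
    (hρ : IsDensityMatrix ρ) : EvolutionWellDefined ω₀ δ J ρ t :=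
  ⟨summable_dysonTerm hf ω₀ δ t, integrable_sector hf ω₀ δ t ρ,
    (hasSum_sectorState hf ω₀ δ t ρ).summable, isDensityMatrix_reducedState hf ω₀ δ t hρ⟩

theorem IsBandDensity.samplingError_le (hJ : IsBandDensity Ω M J) (ω₀ δ : ℝ)
    (hρ : IsDensityMatrix ρ) {Δt : ℝ} (hΔt : 0 ≤ Δt) :
    samplingError ω₀ δ J ρ Δt ≤ 4 * ∫ t' in (0 : ℝ)..Δt, ∫ t'' in (0 : ℝ)..t',
      ‖correlationError J Δt (t' - t'')‖ := by
  have hf := hJ.isBandFamily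
  have hg := (hJ.sampled Δt).isBandFamily
  have him := im_fockForm_matrix_smul hρ.1.1 isHermitian_σz Ω
  rw [samplingError, expectSigmaZ_eq_fockForm hf, expectSigmaZ_eq_fockForm hg,
    ← Complex.abs_re_eq_norm.2 (by rw [Complex.sub_im, him, him, sub_zero]), Complex.sub_re]
  refine (abs_re_fockForm_sub_le_lowPass hρ.1 ((isRapidFamily_evolved hf ω₀ δ).isRapid Δt)
    ((isRapidFamily_evolved hg ω₀ δ).isRapid Δt) (fockNormSq_evolved hf ω₀ δ hρ Δt)
    (fockNormSq_evolved hg ω₀ δ hρ Δt) (Real.pi / Δt) isHermitian_σz σz_mul_σz).trans ?_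
  gcongr
  exact hJ.sqrt_fockNormSq_lowPass_sub_le ω₀ δ Δt hρ hΔt

end Reduced

/-! ### Shannon's sampling theorem -/

section Sampling

variable {Δt : ℝ} {g : ℝ → ℂ}

lemma hasSum_conj_fourierCoeffOn_mul {a b : ℝ} {f g : ℝ → ℂ} (hab : a < b)
    (hf : MemLp f 2 (volume.restrict (Set.Ioc a b)))
    (hg : MemLp g 2 (volume.restrict (Set.Ioc a b))) :
    HasSum (fun i : ℤ => conj (fourierCoeffOn hab f i) * fourierCoeffOn hab g i)
      ((b - a)⁻¹ • ∫ x in a..b, conj (f x) * g x) := by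
  have := Fact.mk (sub_pos.2 hab)
  rw [← add_sub_cancel a b] at hf hg
  have hF := hf.memLp_liftIoc.haarAddCircle
  have hG := hg.memLp_liftIoc.haarAddCircle
  have hcoeff (i : ℤ) : inner ℂ (fourierBasis i) (hG.toLp _) = fourierCoeffOn hab g i := by
    rw [← HilbertBasis.repr_apply_apply, fourierBasis_repr, fourierCoeff_congr_ae hG.coeFn_toLp]
    rfl
  have hcoeff_conj (i : ℤ) :
      inner ℂ (hF.toLp _) (fourierBasis i) = conj (fourierCoeffOn hab f i) := by
    rw [← inner_conj_symm, ← HilbertBasis.repr_apply_apply, fourierBasis_repr,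
      fourierCoeff_congr_ae hF.coeFn_toLp]
    rfl
  have hinner : inner ℂ (hF.toLp _) (hG.toLp _) =
      (b - a)⁻¹ • ∫ x in a..b, conj (f x) * g x := by
    rw [← congrArg (fun c => ∫ x in a..c, conj (f x) * g x) (add_sub_cancel a b),
      ← AddCircle.integral_liftIoc_eq_intervalIntegral, ← AddCircle.integral_haarAddCircle,
      L2.inner_def]
    refine integral_congr_ae ?_
    filter_upwards [hF.coeFn_toLp, hG.coeFn_toLp] with x hx hy
    rw [hx, hy, RCLike.inner_apply']
    rfl
  simpa only [hcoeff, hcoeff_conj, hinner] using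
    fourierBasis.hasSum_inner_mul_inner hF.toLp hG.toLp

lemma integral_exp_I_mul_mul (Λ c : ℝ) :
    ∫ x in (-Λ)..Λ, Complex.exp (Complex.I * c * x) = 2 * Λ * Real.sinc (c * Λ) := by
  rcases eq_or_ne c 0 with rfl | hc
  · simp
    ring
  · have hc' : (c : ℂ) ≠ 0 := Complex.ofReal_ne_zero.2 hc
    have hphase (x : ℝ) : Complex.I * c * x = ((c * x : ℝ) : ℂ) * Complex.I := by
      push_cast
      ring
    simp only [hphase]
    rw [intervalIntegral.integral_comp_mul_left (fun t : ℝ => Complex.exp (t * Complex.I)) hc,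
      mul_neg, integral_exp_mul_I_eq_sinc, Complex.real_smul]
    push_cast
    field_simp

lemma fourierCoeffOn_neg_pi_div (hΔt : 0 < Δt) (g : ℝ → ℂ) (n : ℤ) :
    fourierCoeffOn (neg_lt_self (div_pos Real.pi_pos hΔt)) g n =
      (2 * (Real.pi / Δt) : ℂ)⁻¹ * ∫ x in (-(Real.pi / Δt))..(Real.pi / Δt),
        g x * Complex.exp (-Complex.I * x * ((n * Δt : ℝ) : ℂ)) := by
  have hΔt' : (Δt : ℂ) ≠ 0 := Complex.ofReal_ne_zero.2 hΔt.ne'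
  have hπ : (Real.pi : ℂ) ≠ 0 := Complex.ofReal_ne_zero.2 Real.pi_ne_zero
  have hphase (x : ℝ) : fourier (-n) (x : AddCircle (Real.pi / Δt - -(Real.pi / Δt))) =
      Complex.exp (-Complex.I * x * ((n * Δt : ℝ) : ℂ)) := by
    rw [fourier_coe_apply]
    congr 1
    push_cast
    field_simp
    ring
  rw [fourierCoeffOn_eq_integral]
  simp only [hphase, smul_eq_mul, mul_comm (Complex.exp _), Complex.real_smul]
  congr 1
  push_cast
  ring

lemma fourierCoeffOn_exp_I_mul_mul (hΔt : 0 < Δt) (τ : ℝ) (n : ℤ) :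
    fourierCoeffOn (neg_lt_self (div_pos Real.pi_pos hΔt))
        (fun x : ℝ => Complex.exp (Complex.I * τ * x)) n =
      (Real.sinc (Real.pi * (τ / Δt - n)) : ℂ) := by
  have hΔt' : (Δt : ℂ) ≠ 0 := Complex.ofReal_ne_zero.2 hΔt.ne'
  have hπ : (Real.pi : ℂ) ≠ 0 := Complex.ofReal_ne_zero.2 Real.pi_ne_zero
  have hphase (x : ℝ) : Complex.exp (Complex.I * τ * x) *
      Complex.exp (-Complex.I * x * ((n * Δt : ℝ) : ℂ)) =
        Complex.exp (Complex.I * ((τ - n * Δt : ℝ) : ℂ) * x) := by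
    rw [← Complex.exp_add]
    congr 1
    push_cast
    ring
  have harg : (τ - n * Δt) * (Real.pi / Δt) = Real.pi * (τ / Δt - n) := by field_simp
  rw [fourierCoeffOn_neg_pi_div hΔt]
  simp only [hphase]
  rw [integral_exp_I_mul_mul, harg]
  push_cast
  field_simp

-- Parseval's identity for `x ↦ exp (i τ x)` and `g`, whose Fourier coefficients on
-- `[-π / Δt, π / Δt]` are the cardinal sines and the samples.
theorem hasSum_integral_mul_exp_mul_sinc (hΔt : 0 < Δt)
    (hg : MemLp g 2 (volume.restrict (Set.Ioc (-(Real.pi / Δt)) (Real.pi / Δt)))) (τ : ℝ) :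
    HasSum
      (fun n : ℤ => (∫ x in (-(Real.pi / Δt))..(Real.pi / Δt),
        g x * Complex.exp (-Complex.I * x * ((n * Δt : ℝ) : ℂ))) *
          (Real.sinc (Real.pi * (τ / Δt - n)) : ℂ))
      (∫ x in (-(Real.pi / Δt))..(Real.pi / Δt), g x * Complex.exp (-Complex.I * x * τ)) := by
  have hΛ : (2 * (Real.pi / Δt) : ℂ) ≠ 0 := by
    exact_mod_cast (mul_pos two_pos (div_pos Real.pi_pos hΔt)).ne'
  have hlength : (((Real.pi / Δt - -(Real.pi / Δt))⁻¹ : ℝ) : ℂ) =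
      (2 * (Real.pi / Δt) : ℂ)⁻¹ := by
    push_cast
    ring
  have hexp : MemLp (fun x : ℝ => Complex.exp (Complex.I * τ * x)) 2
      (volume.restrict (Set.Ioc (-(Real.pi / Δt)) (Real.pi / Δt))) :=
    .of_bound (by fun_prop) 1 (.of_forall fun x => (norm_exp_I_mul_mul τ x).le)
  have hconj (x : ℝ) : conj (Complex.exp (Complex.I * τ * x)) * g x =
      g x * Complex.exp (-Complex.I * x * τ) := by
    rw [← Complex.exp_conj, mul_comm]
    simp only [map_mul, Complex.conj_I, Complex.conj_ofReal, mul_right_comm]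
  have hcancel (s z : ℂ) :
      (2 * (Real.pi / Δt) : ℂ) * (s * ((2 * (Real.pi / Δt) : ℂ)⁻¹ * z)) = z * s := by
    rw [mul_left_comm, mul_inv_cancel_left₀ hΛ, mul_comm]
  have hparseval := (hasSum_conj_fourierCoeffOn_mul (neg_lt_self (div_pos Real.pi_pos hΔt))
    hexp hg).mul_left (2 * (Real.pi / Δt) : ℂ)
  simp only [fourierCoeffOn_exp_I_mul_mul hΔt, fourierCoeffOn_neg_pi_div hΔt, Complex.conj_ofReal,
    hconj, Complex.real_smul, hlength, hcancel, mul_inv_cancel_left₀ hΛ] at hparseval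
  exact hparseval

lemma IsBandDensity.hasSum_bathCorrelation_mul_sinc {J : ℝ → ℝ} {Ω M : ℝ}
    (hJ : IsBandDensity Ω M J) (hΔt : 0 < Δt) (hΩ : Ω ≤ Real.pi / Δt) (τ : ℝ) :
    HasSum (fun n : ℤ => bathCorrelation J (n * Δt) * (Real.sinc (Real.pi * (τ / Δt - n)) : ℂ))
      (bathCorrelation J τ) := by
  have hΛ : -(Real.pi / Δt) < 0 := neg_lt_zero.2 (div_pos Real.pi_pos hΔt)
  have hband (u : ℝ) : bathCorrelation J u = ∫ x in (-(Real.pi / Δt))..(Real.pi / Δt),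
      (J x : ℂ) * Complex.exp (-Complex.I * x * u) := by
    rw [intervalIntegral.integral_of_le (neg_le_self (div_pos Real.pi_pos hΔt).le),
      setIntegral_eq_integral_of_forall_compl_eq_zero]
    · rfl
    · intro x hx
      have hout : x ∉ Set.Icc 0 Ω := fun h => hx ⟨hΛ.trans_le h.1, h.2.trans hΩ⟩
      rw [hJ.eq_zero x hout, Complex.ofReal_zero, zero_mul]
  have hmem : MemLp (fun x => (J x : ℂ)) 2
      (volume.restrict (Set.Ioc (-(Real.pi / Δt)) (Real.pi / Δt))) := by
    refine .of_bound (Complex.measurable_ofReal.comp hJ.measurable).aestronglyMeasurable (M ^ 2)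
      (.of_forall fun x => ?_)
    rw [Complex.norm_real, Real.norm_of_nonneg (hJ.nonneg x)]
    exact (Real.sqrt_le_left ((Real.sqrt_nonneg _).trans (hJ.sqrt_le x))).1 (hJ.sqrt_le x)
  simp only [hband]
  exact hasSum_integral_mul_exp_mul_sinc hΔt hmem τ

end Sampling

/-! ### The Ohmic bath -/

section Ohmic

variable {α ωc Δt : ℝ}

lemma isBandDensity_ohmicSD (hα : 0 ≤ α) (ωc : ℝ) :
    IsBandDensity ωc (√(2 * α * ωc)) (ohmicSD α ωc) where
  measurable := Measurable.indicator (by fun_prop) measurableSet_Icc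
  nonneg x := Set.indicator_nonneg
    (fun _ hx => mul_nonneg (mul_nonneg two_pos.le hα) hx.1) x
  sqrt_le x := by
    by_cases hx : x ∈ Set.Icc 0 ωc
    · rw [ohmicSD, Set.indicator_of_mem hx]
      gcongr
      exact hx.2
    · rw [ohmicSD, Set.indicator_of_notMem hx, Real.sqrt_zero]
      exact Real.sqrt_nonneg _
  eq_zero _ hx := Set.indicator_of_notMem hx _

lemma sampledSD_ohmicSD (α : ℝ) (h : ωc ≤ Real.pi / Δt) :
    sampledSD (ohmicSD α ωc) Δt = ohmicSD α ωc :=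
  Set.indicator_eq_self.2 fun _ hx => (Set.support_indicator_subset hx).2.trans h

lemma unresolvedSD_ohmicSD (α ωc : ℝ) (hΔt : 0 ≤ Δt) :
    unresolvedSD (ohmicSD α ωc) Δt =
      (Set.Ioc (Real.pi / Δt) ωc).indicator fun ω => 2 * α * ω := by
  rw [unresolvedSD, ohmicSD, Set.indicator_indicator]
  congr 1
  ext x
  have hΛ : 0 ≤ Real.pi / Δt := div_nonneg Real.pi_pos.le hΔt
  exact ⟨fun h => ⟨h.1, h.2.2⟩, fun h => ⟨h.1, hΛ.trans h.1.le, h.2⟩⟩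

lemma correlationError_ohmicSD (hα : 0 ≤ α) (hΔt : 0 ≤ Δt) (h : Real.pi / Δt ≤ ωc) (τ : ℝ) :
    correlationError (ohmicSD α ωc) Δt τ = ∫ ω in (Real.pi / Δt)..ωc,
      ((2 * α * ω : ℝ) : ℂ) * Complex.exp (-Complex.I * ω * τ) := by
  rw [(isBandDensity_ohmicSD hα ωc).correlationError_eq, bathCorrelation,
    unresolvedSD_ohmicSD α ωc hΔt, intervalIntegral.integral_of_le h,
    ← integral_indicator measurableSet_Ioc]
  congr 1
  funext x
  by_cases hx : x ∈ Set.Ioc (Real.pi / Δt) ωc <;> simp [hx]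

lemma hasDerivAt_exp_neg_I_mul_mul_one_add {τ : ℝ} (hτ : τ ≠ 0) (α x : ℝ) :
    HasDerivAt (fun x : ℝ => 2 * α / τ ^ 2 *
        (Complex.exp (-Complex.I * x * τ) * (1 + Complex.I * x * τ)))
      (((2 * α * x : ℝ) : ℂ) * Complex.exp (-Complex.I * x * τ)) x := by
  have hτ' : (τ : ℂ) ≠ 0 := Complex.ofReal_ne_zero.2 hτ
  have hlin (c : ℂ) : HasDerivAt (fun x : ℝ => c * x * τ) (c * 1 * τ) x :=
    (Complex.ofRealCLM.hasDerivAt.const_mul c).mul_const _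
  refine (((hlin (-Complex.I)).cexp.mul ((hlin Complex.I).const_add 1)).const_mul
    (2 * α / τ ^ 2 : ℂ)).congr_deriv ?_
  push_cast
  field_simp
  ring_nf
  rw [Complex.I_sq]
  ring

lemma correlationError_ohmicSD_of_ne_zero (hα : 0 ≤ α) (hΔt : 0 ≤ Δt) (h : Real.pi / Δt ≤ ωc)
    {τ : ℝ} (hτ : τ ≠ 0) :
    correlationError (ohmicSD α ωc) Δt τ = 2 * α / τ ^ 2 *
      (Complex.exp (-Complex.I * ωc * τ) * (1 + Complex.I * ωc * τ) -
        Complex.exp (-Complex.I * (Real.pi * τ / Δt)) *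
          (1 + Complex.I * (Real.pi * τ / Δt))) := by
  have hphase (c : ℂ) : c * ((Real.pi / Δt : ℝ) : ℂ) * τ = c * (Real.pi * τ / Δt) := by
    push_cast
    ring
  rw [correlationError_ohmicSD hα hΔt h, intervalIntegral.integral_eq_sub_of_hasDerivAt
    (fun x _ => hasDerivAt_exp_neg_I_mul_mul_one_add hτ α x)
    (Continuous.intervalIntegrable (by fun_prop) _ _), hphase, hphase, mul_sub]

lemma norm_correlationError_ohmicSD_le (hα : 0 ≤ α) (hΔt : 0 ≤ Δt) (h : Real.pi / Δt ≤ ωc)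
    (τ : ℝ) : ‖correlationError (ohmicSD α ωc) Δt τ‖ ≤ α * (ωc ^ 2 - (Real.pi / Δt) ^ 2) := by
  have hΛ : 0 ≤ Real.pi / Δt := div_nonneg Real.pi_pos.le hΔt
  have hmass : ∫ ω in (Real.pi / Δt)..ωc, 2 * α * ω = α * (ωc ^ 2 - (Real.pi / Δt) ^ 2) := by
    rw [intervalIntegral.integral_const_mul, integral_id]
    ring
  rw [correlationError_ohmicSD hα hΔt h, ← hmass]
  refine intervalIntegral.norm_integral_le_of_norm_le h (.of_forall fun x hx => ?_)
    (Continuous.intervalIntegrable (by fun_prop) _ _)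
  have hx0 : 0 ≤ x := hΛ.trans hx.1.le
  exact (norm_mul_exp_neg_I_mul_mul (by positivity) x τ).le

lemma integral_integral_comp_sub_le {c : ℝ → ℝ} {C t : ℝ} (hc : Continuous c) (hC : ∀ τ, c τ ≤ C)
    (ht : 0 ≤ t) : ∫ t' in (0 : ℝ)..t, ∫ t'' in (0 : ℝ)..t', c (t' - t'') ≤ C * (t ^ 2 / 2) := by
  have hinner (t' : ℝ) (ht' : 0 ≤ t') : ∫ t'' in (0 : ℝ)..t', c (t' - t'') ≤ C * t' :=
    calc ∫ t'' in (0 : ℝ)..t', c (t' - t'') ≤ ∫ _ in (0 : ℝ)..t', C :=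
          intervalIntegral.integral_mono_on ht'
            (Continuous.intervalIntegrable (by fun_prop) _ _)
            (continuous_const.intervalIntegrable _ _) fun s _ => hC (t' - s)
      _ = C * t' := by rw [intervalIntegral.integral_const, sub_zero, smul_eq_mul, mul_comm]
  calc ∫ t' in (0 : ℝ)..t, ∫ t'' in (0 : ℝ)..t', c (t' - t'') ≤ ∫ t' in (0 : ℝ)..t, C * t' :=
        intervalIntegral.integral_mono_on ht
          ((continuous_integral_comp_sub hc).intervalIntegrable _ _)
          (Continuous.intervalIntegrable (by fun_prop) _ _) fun s hs => hinner s hs.1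
    _ = C * (t ^ 2 / 2) := by
        rw [intervalIntegral.integral_const_mul, integral_id]
        ring

theorem samplingError_ohmicSD_le (hα : 0 ≤ α) (ω₀ δ : ℝ) {ρ : Matrix (Fin 2) (Fin 2) ℂ}
    (hρ : IsDensityMatrix ρ) (hΔt : 0 < Δt) (h : Real.pi / Δt ≤ ωc) :
    samplingError ω₀ δ (ohmicSD α ωc) ρ Δt ≤
      2 * Real.pi ^ 2 * α * ((ωc * Δt / Real.pi) ^ 2 - 1) := by
  have hJ := isBandDensity_ohmicSD hα ωc
  have hπ := Real.pi_ne_zero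
  calc samplingError ω₀ δ (ohmicSD α ωc) ρ Δt
      ≤ 4 * ∫ t' in (0 : ℝ)..Δt, ∫ t'' in (0 : ℝ)..t',
          ‖correlationError (ohmicSD α ωc) Δt (t' - t'')‖ := hJ.samplingError_le ω₀ δ hρ hΔt.le
    _ ≤ 4 * (α * (ωc ^ 2 - (Real.pi / Δt) ^ 2) * (Δt ^ 2 / 2)) := by
        gcongr
        exact integral_integral_comp_sub_le (hJ.continuous_correlationError Δt).norm
          (norm_correlationError_ohmicSD_le hα hΔt.le h) hΔt.le
    _ = 2 * Real.pi ^ 2 * α * ((ωc * Δt / Real.pi) ^ 2 - 1) := by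
        field_simp
        ring

lemma two_mul_pi_sq_mul_le (hα : 0 ≤ α) (ωc Δt : ℝ) :
    2 * Real.pi ^ 2 * α * ((ωc * Δt / Real.pi) ^ 2 - 1) ≤ 2 * α * ωc ^ 2 * Δt ^ 2 := by
  have hexpand : 2 * Real.pi ^ 2 * α * ((ωc * Δt / Real.pi) ^ 2 - 1) =
      2 * α * ωc ^ 2 * Δt ^ 2 - 2 * Real.pi ^ 2 * α := by
    field_simp [Real.pi_ne_zero]
  rw [hexpand]
  exact sub_le_self _ (by positivity)

end Ohmic

end SpinBoson

end

theorem mainTheorem4 (α ωc : ℝ) (hα : 0 ≤ α) (hωc : 0 < ωc) (ω₀ δ : ℝ)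
    (ρ : Matrix (Fin 2) (Fin 2) ℂ) (hρ : SpinBoson.IsDensityMatrix ρ)
    (Δt : ℝ) (hΔt : 0 < Δt) :
    -- both dynamics are well defined
    (SpinBoson.EvolutionWellDefined ω₀ δ (SpinBoson.ohmicSD α ωc) ρ Δt ∧
      SpinBoson.EvolutionWellDefined ω₀ δ
        (SpinBoson.sampledSD (SpinBoson.ohmicSD α ωc) Δt) ρ Δt) ∧
    -- the general bound of the sampling error by the error of the bath correlation function
    SpinBoson.samplingError ω₀ δ (SpinBoson.ohmicSD α ωc) ρ Δt ≤
      Real.exp (4 * ∫ t' in (0 : ℝ)..Δt, ∫ t'' in (0 : ℝ)..t',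
        ‖SpinBoson.correlationError (SpinBoson.ohmicSD α ωc) Δt (t' - t'')‖) - 1 ∧
    -- small time steps: perfect reconstruction from the samples, and no sampling error
    (Δt ≤ Real.pi / ωc →
      (∀ τ : ℝ, HasSum
        (fun n : ℤ => SpinBoson.bathCorrelation (SpinBoson.ohmicSD α ωc) (n * Δt) *
          (Real.sinc (Real.pi * (τ / Δt - n)) : ℂ))
        (SpinBoson.bathCorrelation (SpinBoson.ohmicSD α ωc) τ)) ∧
      (∀ τ : ℝ, SpinBoson.correlationError (SpinBoson.ohmicSD α ωc) Δt τ = 0) ∧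
      SpinBoson.samplingError ω₀ δ (SpinBoson.ohmicSD α ωc) ρ Δt = 0) ∧
    -- large time steps
    (Real.pi / ωc ≤ Δt →
      (∀ τ : ℝ, SpinBoson.correlationError (SpinBoson.ohmicSD α ωc) Δt τ =
        ∫ ω in (Real.pi / Δt)..ωc,
          ((2 * α * ω : ℝ) : ℂ) * Complex.exp (-Complex.I * ω * τ)) ∧
      (∀ τ : ℝ, τ ≠ 0 → SpinBoson.correlationError (SpinBoson.ohmicSD α ωc) Δt τ =
        2 * α / τ ^ 2 *
          (Complex.exp (-Complex.I * ωc * τ) * (1 + Complex.I * ωc * τ) -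
            Complex.exp (-Complex.I * (Real.pi * τ / Δt)) *
              (1 + Complex.I * (Real.pi * τ / Δt)))) ∧
      SpinBoson.samplingError ω₀ δ (SpinBoson.ohmicSD α ωc) ρ Δt ≤
        2 * Real.pi ^ 2 * α * ((ωc * Δt / Real.pi) ^ 2 - 1) ∧
      SpinBoson.samplingError ω₀ δ (SpinBoson.ohmicSD α ωc) ρ Δt ≤
        2 * α * ωc ^ 2 * Δt ^ 2) := by
  have hJ := SpinBoson.isBandDensity_ohmicSD hα ωc
  refine ⟨⟨SpinBoson.evolutionWellDefined hJ.isBandFamily ω₀ δ Δt hρ,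
    SpinBoson.evolutionWellDefined (hJ.sampled Δt).isBandFamily ω₀ δ Δt hρ⟩,
    (hJ.samplingError_le ω₀ δ hρ hΔt.le).trans (le_sub_iff_add_le.2 (Real.add_one_le_exp _)),
    fun hsmall => ?_, fun hlarge => ?_⟩
  · have hcutoff : ωc ≤ Real.pi / Δt := (le_div_comm₀ hΔt hωc).1 hsmall
    have hresolved := SpinBoson.sampledSD_ohmicSD α hcutoff
    refine ⟨hJ.hasSum_bathCorrelation_mul_sinc hΔt hcutoff, fun τ => ?_, ?_⟩
    · rw [SpinBoson.correlationError, hresolved, sub_self]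
    · rw [SpinBoson.samplingError, hresolved, sub_self, norm_zero]
  · have hcutoff : Real.pi / Δt ≤ ωc := (div_le_comm₀ hωc hΔt).1 hlarge
    have hbound := SpinBoson.samplingError_ohmicSD_le hα ω₀ δ hρ hΔt hcutoff
    exact ⟨SpinBoson.correlationError_ohmicSD hα hΔt.le hcutoff,
      fun _ => SpinBoson.correlationError_ohmicSD_of_ne_zero hα hΔt.le hcutoff, hbound,
      hbound.trans (SpinBoson.two_mul_pi_sq_mul_le hα ωc Δt)⟩
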